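/- **Setting.** Let $\nu$ be a probability measure on $\mathbb R$ with mean $0$ and variance $1$. For each $n$ let $J=(J_{jk})_{1\le j<k\le n}$ be i.i.d. with law $\nu$; write $\mathbb E_J,\mathbb P_J$ for expectation and probability over $J$. The Sherrington–Kirkpatrick cost function is $C(z)=n^{-1/2}\sum_{j<k}J_{jk}z_jz_k$ for $z\in\{\pm1\}^n$, also regarded as the diagonal operator $C|z\rangle=C(z)|z\rangle$ on $n$ qubits. Let $B=\sum_{j=1}^n X_j$ be the sum of the Pauli $X$ operators and $|s\rangle=2^{-n/2}\sum_z|z\rangle$. For $p\ge0$ and $\gamma,\beta\in\mathbb R^p$ the QAOA state is $$|\gamma,\beta\rangle=e^{-i\beta_pB}e^{-i\gamma_pC}\cdots e^{-i\beta_1B}e^{-i\gamma_1C}|s\rangle,$$ and $\langle O\rangle=\langle\gamma,\beta|O|\gamma,\beta\rangle$. **The limiting energy.** Let $A$ be the set of configurations $a=(a_1,\dots,a_p,a_{-p},\dots,a_{-1})\in\{\pm1\}^{2p}$, with bitwise product $ab$. Put $a^*_{r}=a_ra_{r+1}\cdots a_p$ and $a^*_{-r}=a_{-r}a_{-r-1}\cdots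 a_{-p}$ for $1\le r\le p$, $\Phi_a=\sum_{r=1}^p\gamma_r(a_r^*-a_{-r}^*)$, $\theta(b)=(1+b)/2$, and $$Q_a=\prod_{j=1}^p(\cos\beta_j)^{\theta(a_j)+\theta(a_{-j})}(\sin\beta_j)^{\theta(-a_j)+\theta(-a_{-j})}\,i^{\,\theta(-a_j)-\theta(-a_{-j})}.$$ Let $A_{p+1}=\{a: a_{-r}=a_r\ \forall r\}$. For $a\notin A_{p+1}$ let $r(a)$ be the largest $r$ with $a_{-r}=-a_r$, and let $\bar a$ be $a$ with the signs of $a_{r(a)}$ and $a_{-r(a)}$ flipped. Put $$F_b=\exp\Big[-\tfrac12\sum_{a\in A_{p+1}}Q_a\Phi_{ab}^2\Big],\qquad X_b=Q_bF_b,\qquad K_{b,c}=\tfrac12X_b\big(\Phi_{\bar bc}^2-\Phi_{bc}^2\big).$$ Let $D=\{b\in A\setminus A_{p+1}: b_1\cdots b_p=1\}$. Start with $R_j=1$ for all $j$, run through the elements $s$ of $D$ in an order in which $r(s)$ is non-decreasing, and at each of them replace $R_j$ by $R_j\exp(R_sK_{s,j})$ for all $j$. With the final values of $R$ let $Y_u=\exp[\sum_{j\in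 D}R_jK_{j,u}]$ and $W_u=X_uY_u$ for $u\in A$, and $$V_p(\gamma,\beta)=\frac i2\sum_{r=1}^p\gamma_r\Big[\sum_{u\in A}(u_r^*+u_{-r}^*)W_u\Big]\Big[\sum_{v\in A}(v_r^*-v_{-r}^*)W_v\Big].$$ **Claim.** For every $\nu$ as above, every fixed $p$ and all $\gamma,\beta\in\mathbb R^p$, the number $V_p=V_p(\gamma,\beta)$ is real, the expectations below exist, and the following hold. 1. As $n\to\infty$, $\mathbb E_J[\langle C/n\rangle]\to V_p$, and $$\lim_{n\to\infty}\mathbb E_J[\langle (C/n)^2\rangle]=V_p^2=\lim_{n\to\infty}\big(\mathbb E_J[\langle C/n\rangle]\big)^2 .$$ 2. (Concentration over instances, landscape independence.) $\mathbb E_J[\langle C/n\rangle^2]-(\mathbb E_J[\langle C/n\rangle])^2\to0$, and $\mathbb P_J(|\langle C/n\rangle-V_p|>\varepsilon)\to0$ for every $\varepsilon>0$. 3. (Concentration over measurements.) The measurement variance $\langle (C/n)^2\rangle-\langle C/n\rangle^2$ is nonnegative for every $J$; its expectation over $J$ tends to $0$, and it tends to $0$ in probability over $J$. Moreover, for all $\varepsilon,\delta>0$,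 with $\mathbb P_J$-probability tending to $1$ as $n\to\infty$ the instance $J$ has the following property: a string $z$ obtained by measuring $|\gamma,\beta\rangle$ in the computational basis satisfies $|C(z)/n-V_p|>\varepsilon$ with probability at most $\delta$. -/

import Mathlib

open MeasureTheory ProbabilityTheory Filter Topology
open scoped Matrix

namespace SKQAOA

noncomputable section

/-! ## The Sherrington-Kirkpatrick model -/

/-- Strings `z ∈ {+1,-1}^n`; the group `ℤˣ` is `{+1,-1}`. -/
abbrev Spins (n : ℕ) : Type := Fin n → ℤˣ

/-- A sign as a real number. -/
def sgn (s : ℤˣ) : ℝ := ((s : ℤ) : ℝ)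

/-- The pairs `j < k` that carry a coupling. -/
abbrev Pairs (n : ℕ) : Type := {e : Fin n × Fin n // e.1 < e.2}

/-- An instance: one real coupling `J_{jk}` for every `j < k`. -/
abbrev Couplings (n : ℕ) : Type := Pairs n → ℝ

/-- The law of an instance: the couplings are independent with common law `ν`. -/
def instanceLaw (ν : Measure ℝ) (n : ℕ) : Measure (Couplings n) :=
  Measure.pi fun _ : Pairs n => ν

/-- `C(z) = n^{-1/2} ∑_{j<k} J_{jk} z_j z_k`. -/
def cost {n : ℕ} (J : Couplings n) (z : Spins n) : ℝ :=
  (1 / Real.sqrt n) * ∑ e : Pairs n, J e * sgn (z e.1.1) * sgn (z e.1.2)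

/-! ## The quantum circuit on `n` qubits -/

/-- Operators on `n` qubits, as matrices in the computational basis. -/
abbrev Op (n : ℕ) : Type := Matrix (Spins n) (Spins n) ℂ

/-- The cost function as a diagonal operator. -/
def costOp {n : ℕ} (J : Couplings n) : Op n :=
  Matrix.diagonal fun z => (cost J z : ℂ)

/-- The Pauli operator `X_j`, which maps `|z⟩` to `|z⟩` with the `j`-th sign flipped. -/
def pauliX {n : ℕ} (j : Fin n) : Op n :=
  Matrix.of fun z' z => if z' = Function.update z j (-z j) then 1 else 0

/-- `B = ∑_j X_j`. -/
def mixer (n : ℕ) : Op n := ∑ j : Fin n, pauliX j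

/-- `U(C,γ) = e^{-iγC}`. -/
def costUnitary {n : ℕ} (J : Couplings n) (γ : ℝ) : Op n :=
  NormedSpace.exp ((-(Complex.I * (γ : ℂ))) • costOp J)

/-- `U(B,β) = e^{-iβB}`. -/
def mixerUnitary (n : ℕ) (β : ℝ) : Op n :=
  NormedSpace.exp ((-(Complex.I * (β : ℂ))) • mixer n)

/-- `|s⟩ = 2^{-n/2} ∑_z |z⟩`. -/
def uniformState (n : ℕ) : Spins n → ℂ := fun _ => ((1 / Real.sqrt (2 ^ n) : ℝ) : ℂ)

/-- `|γ,β⟩ = U(B,β_p) U(C,γ_p) ⋯ U(B,β_1) U(C,γ_1) |s⟩`; the layer with index `0 : Fin p`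
acts first. -/
def qaoaState {n p : ℕ} (J : Couplings n) (γ β : Fin p → ℝ) : Spins n → ℂ :=
  (List.finRange p).foldl
    (fun ψ r => mixerUnitary n (β r) *ᵥ (costUnitary J (γ r) *ᵥ ψ)) (uniformState n)

/-- `⟨ψ|O|ψ⟩`. -/
def braket {n : ℕ} (ψ : Spins n → ℂ) (O : Op n) : ℂ := star ψ ⬝ᵥ (O *ᵥ ψ)

/-- The operator `C/n`. -/
def energyOp {n : ℕ} (J : Couplings n) : Op n := ((n : ℂ)⁻¹) • costOp J

/-- `⟨γ,β|(C/n)^k|γ,β⟩`, a real number since `C` is Hermitian. -/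
def energyMoment {n p : ℕ} (k : ℕ) (γ β : Fin p → ℝ) (J : Couplings n) : ℝ :=
  (braket (qaoaState J γ β) (energyOp J ^ k)).re

/-- The probability that measuring `|γ,β⟩` in the computational basis returns a string
in `S`. -/
def measureProb {n p : ℕ} (γ β : Fin p → ℝ) (J : Couplings n) (S : Set (Spins n)) : ℝ :=
  ∑ z : Spins n, S.indicator (fun z => ‖qaoaState J γ β z‖ ^ 2) z

/-! ## The limiting energy `V_p(γ,β)` -/

/-- Configurations `(a_1,…,a_p,a_{-p},…,a_{-1})` of signs: the first component lists
`a_1,…,a_p` and the second one `a_{-1},…,a_{-p}`. Products of configurations are bitwise. -/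
abbrev Config (p : ℕ) : Type := (Fin p → ℤˣ) × (Fin p → ℤˣ)

variable {p : ℕ}

/-- `x*_r = x_r x_{r+1} ⋯ x_p`. -/
def starProd (x : Fin p → ℤˣ) (r : Fin p) : ℝ := sgn (∏ s ∈ Finset.Ici r, x s)

/-- `Φ_c = ∑_r γ_r (c*_r - c*_{-r})`. -/
def Phi (γ : Fin p → ℝ) (c : Config p) : ℝ :=
  ∑ r : Fin p, γ r * (starProd c.1 r - starProd c.2 r)

/-- `θ(b) = (1 + b) / 2`. -/
def theta (b : ℤˣ) : ℕ := if b = 1 then 1 else 0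

/-- `Q_a`. -/
def Q (β : Fin p → ℝ) (a : Config p) : ℂ :=
  ∏ j : Fin p,
    (Real.cos (β j) : ℂ) ^ (theta (a.1 j) + theta (a.2 j)) *
    (Real.sin (β j) : ℂ) ^ (theta (-a.1 j) + theta (-a.2 j)) *
    Complex.I ^ ((theta (-a.1 j) : ℤ) - (theta (-a.2 j) : ℤ))

/-- `r` is the largest index with `a_{-r} = -a_r`. With `r` running over `1,…,p`, this says
that `a` lies in the class `A_ℓ`, `ℓ = p - r + 1`. -/
def IsPivot (a : Config p) (r : Fin p) : Prop :=
  a.2 r = -a.1 r ∧ ∀ s : Fin p, r < s → a.2 s = a.1 s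

instance (a : Config p) (r : Fin p) : Decidable (IsPivot a r) := by
  unfold IsPivot; infer_instance

/-- The bar operation: flip both signs at the pivot. -/
def bar (a : Config p) : Config p :=
  (fun r => if IsPivot a r then -a.1 r else a.1 r,
   fun r => if IsPivot a r then -a.2 r else a.2 r)

/-- The class `A_{p+1}` of configurations with `a_{-r} = a_r` for all `r`. -/
def symmetricConfigs (p : ℕ) : Finset (Config p) :=
  Finset.univ.filter fun a => a.2 = a.1

/-- `F_b = exp(-½ ∑_{a ∈ A_{p+1}} Q_a Φ_{ab}²)`. -/
def F (γ β : Fin p → ℝ) (b : Config p) : ℂ :=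
  Complex.exp (-(1 / 2) * ∑ a ∈ symmetricConfigs p, Q β a * ((Phi γ (a * b) : ℝ) : ℂ) ^ 2)

/-- `X_b = Q_b F_b`. -/
def X (γ β : Fin p → ℝ) (b : Config p) : ℂ := Q β b * F γ β b

/-- `K_{b,c} = ½ X_b (Φ_{b̄c}² - Φ_{bc}²)`. -/
def K (γ β : Fin p → ℝ) (b c : Config p) : ℂ :=
  (1 / 2) * X γ β b * ((Phi γ (bar b * c) ^ 2 - Phi γ (b * c) ^ 2 : ℝ) : ℂ)

/-- The configurations in `D` with pivot `r`, where `D` consists of the configurations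
outside `A_{p+1}` with `a_1 a_2 ⋯ a_p = 1`, one from every pair `{b, b̄}`. -/
def DAt (r : Fin p) : Finset (Config p) :=
  Finset.univ.filter fun a => IsPivot a r ∧ ∏ s, a.1 s = 1

/-- `D` as a list in the order in which it is processed (from the last index `|D|` to the
first): by increasing pivot, that is, by decreasing class `A_ℓ`. -/
def DList (p : ℕ) : List (Config p) :=
  (List.finRange p).flatMap fun r => (DAt r).toList

/-- One step of the iteration: `R_j := R_j exp(R_s K_{s,j})` for all `j`. -/
def updateR (γ β : Fin p → ℝ) (R : Config p → ℂ) (s : Config p) : Config p → ℂ :=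
  fun j => R j * Complex.exp (R s * K γ β s j)

/-- The array `R` at the end of the iteration, started from the constant `1`. (The step for
the first element of `D`, processed last, multiplies by `exp 0` on `D` because that element
plays well with all elements of `D`, so it makes no difference whether it is carried out.) -/
def R (γ β : Fin p → ℝ) : Config p → ℂ :=
  (DList p).foldl (updateR γ β) fun _ => 1

/-- `Y_u = exp(∑_{j ∈ D} R_j K_{j,u})`. -/
def Y (γ β : Fin p → ℝ) (u : Config p) : ℂ :=
  Complex.exp (∑ r : Fin p, ∑ j ∈ DAt r, R γ β j * K γ β j u)

/-- `W_u = X_u Y_u`. -/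
def W (γ β : Fin p → ℝ) (u : Config p) : ℂ := X γ β u * Y γ β u

/-- The formula
`(i/2) ∑_r γ_r [∑_u (u*_r + u*_{-r}) W_u] [∑_v (v*_r - v*_{-r}) W_v]`. -/
def energyFormula (γ β : Fin p → ℝ) : ℂ :=
  (Complex.I / 2) * ∑ r : Fin p, (γ r : ℂ) *
    (∑ u : Config p, ((starProd u.1 r + starProd u.2 r : ℝ) : ℂ) * W γ β u) *
    (∑ v : Config p, ((starProd v.1 r - starProd v.2 r : ℝ) : ℂ) * W γ β v)

/-- `V_p(γ,β)`, as a real number. -/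
def V (γ β : Fin p → ℝ) : ℝ := (energyFormula γ β).re

end

end SKQAOA

namespace SKQAOA

noncomputable section

/-! ## Algebra of configurations -/

section Configurations

variable {p : ℕ}

/-! Inserting the computational basis between the layers writes `|⟨z|γ,β⟩|²` as a double sum over
paths, that is, over one history in `Site p` per qubit: a final sign `z` and the sign changes of the
two branches. During cost layer `r` the spin is `z` times the star product at `r` of its branch. The
phase of a pair of paths is linear in the couplings, so the average over `J` factorises over pairs
of qubits. Each pair contributes `charFun ν (phase / √n) = 1 - phase² / (2n) + o(1/n)`, which
depends on `ν` only through its first two moments to this order. The result is a fully connected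
spin system with complex weights, whose few-site marginals are to be found.

Prescribed sites exert on every other site a field `1 + O(1/n)`. The marginal is expanded in the
number `k` of other sites that contribute the deviation from `1`. No interaction sees the spins
after the last mixer, so unitarity of the mixer sums out the last layer at all sites that are not
prescribed, and marginals with one layer less remain (`marginal_succ`). The binomial coefficient
balances `n^{-k}` and an exponential series emerges. Induction on `p` gives bounds uniform in `n`
(`exists_marginal_bound`), and dominated convergence then gives factorisation into `w_a / 2`
(`tendsto_marginal`), where `w_u = Q_u exp(-½ ∑_a w_a Φ_{au}²)`.

The algorithm defining `W` solves exactly this equation (`isMeanField_W`). The kernel `K` is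
triangular with respect to the pivot, so the iteration ends with `R = Y`; the antisymmetry `W_{ā} =
-W_a` groups the mean field sum into the exponents of `F` and `Y`.

A factor `J_e` in the energy replaces a characteristic function by its first Fourier moment, a
relative factor `i · phase / √n`. Summed over about `n²/2` pairs this gives `V`; in the second
moment disjoint pairs of edges dominate and give `V²`, the rest being `O(1/n)`. Finally `(E⟨C/n⟩)² ≤
E⟨C/n⟩² ≤ E⟨(C/n)²⟩` has equal limits at both ends, and Markov's inequality yields every
concentration statement. -/

lemma sgn_mul (s t : ℤˣ) : sgn (s * t) = sgn s * sgn t := by simp [sgn]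

lemma sgn_neg (s : ℤˣ) : sgn (-s) = -sgn s := by simp [sgn]

@[simp] lemma sgn_one : sgn 1 = 1 := by simp [sgn]

lemma sgn_mul_self (s : ℤˣ) : sgn s * sgn s = 1 := by
  rw [← sgn_mul, Int.units_mul_self, sgn_one]

lemma starProd_mul (x y : Fin p → ℤˣ) (r : Fin p) :
    starProd (x * y) r = starProd x r * starProd y r := by
  simp [starProd, Finset.prod_mul_distrib, sgn_mul]

lemma starProd_mulSingle (r q : Fin p) :
    starProd (Pi.mulSingle r (-1)) q = if q ≤ r then -1 else 1 := by
  unfold starProd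
  simp only [Pi.mulSingle_apply, Finset.prod_ite_eq', Finset.mem_Ici]
  split_ifs <;> simp [sgn]

lemma Phi_mul_comm (γ : Fin p → ℝ) (a b : Config p) : Phi γ (a * b) = Phi γ (b * a) := by
  rw [mul_comm]

lemma IsPivot.unique {a : Config p} {r s : Fin p} (hr : IsPivot a r) (hs : IsPivot a s) :
    s = r := by
  have key : ∀ {r s : Fin p}, IsPivot a r → IsPivot a s → ¬ r < s := by
    intro r s hr hs hlt
    have h := hs.1
    rw [hr.2 s hlt] at h
    exact units_ne_neg_self _ h
  exact le_antisymm (not_lt.1 (key hr hs)) (not_lt.1 (key hs hr))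

lemma bar_eq {a : Config p} {r : Fin p} (hr : IsPivot a r) :
    bar a = a * (Pi.mulSingle r (-1), Pi.mulSingle r (-1)) := by
  have h : ∀ s, IsPivot a s ↔ s = r := fun s => ⟨fun hs => hr.unique hs, fun hs => hs ▸ hr⟩
  unfold bar
  ext s <;> simp only [h, Prod.fst_mul, Prod.snd_mul, Pi.mul_apply, Pi.mulSingle_apply] <;>
    split_ifs <;> simp

lemma IsPivot.bar {a : Config p} {r : Fin p} (hr : IsPivot a r) : IsPivot (bar a) r := by
  rw [bar_eq hr]
  refine ⟨by simp [hr.1], fun s hs => ?_⟩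
  simp [hr.2 s hs]

lemma bar_bar (a : Config p) : bar (bar a) = a := by
  by_cases h : ∃ r, IsPivot a r
  · obtain ⟨r, hr⟩ := h
    rw [bar_eq hr.bar, bar_eq hr, mul_assoc]
    have : (Pi.mulSingle r (-1) : Fin p → ℤˣ) * Pi.mulSingle r (-1) = 1 := by
      rw [← Pi.mulSingle_mul]; simp
    simp [this]
  · have : bar a = a := by
      unfold bar
      simp [not_exists.1 h]
    rw [this, this]

lemma eq_or_exists_isPivot (a : Config p) : a.2 = a.1 ∨ ∃ r, IsPivot a r := by
  by_cases h : a.2 = a.1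
  · exact Or.inl h
  right
  have hne : (Finset.univ.filter fun s => a.2 s ≠ a.1 s).Nonempty := by
    obtain ⟨s, hs⟩ := Function.ne_iff.1 h
    exact ⟨s, by simpa using hs⟩
  refine ⟨Finset.max' _ hne, ?_, fun s hs => ?_⟩
  · have := (Finset.mem_filter.1 (Finset.max'_mem _ hne)).2
    exact Int.units_ne_iff_eq_neg.1 this
  · by_contra hs'
    have := Finset.le_max' (Finset.univ.filter fun s => a.2 s ≠ a.1 s) s
      (Finset.mem_filter.2 ⟨Finset.mem_univ _, hs'⟩)
    exact absurd hs (not_lt.2 this)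

/-- Flipping the pivot of `a` changes the sign of `Φ_{ab}` if `b` is symmetric beyond it. -/
lemma Phi_bar_mul (γ : Fin p → ℝ) {a b : Config p} {r : Fin p} (hr : IsPivot a r)
    (hb : ∀ s, r < s → b.2 s = b.1 s) : Phi γ (bar a * b) = -Phi γ (a * b) := by
  unfold Phi
  rw [← Finset.sum_neg_distrib]
  refine Finset.sum_congr rfl fun q _ => ?_
  rw [bar_eq hr]
  simp only [Prod.fst_mul, Prod.snd_mul, starProd_mul, starProd_mulSingle]
  -- Up to the pivot both star products change sign; beyond it both branches of `a * b` agree, so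
  -- the term is zero on either side.
  split_ifs with hq
  · ring
  · have h1 : starProd a.2 q = starProd a.1 q := by
      unfold starProd
      congr 1
      exact Finset.prod_congr rfl fun s hs =>
        hr.2 s ((not_le.1 hq).trans_le (Finset.mem_Ici.1 hs))
    have h2 : starProd b.2 q = starProd b.1 q := by
      unfold starProd
      congr 1
      exact Finset.prod_congr rfl fun s hs =>
        hb s ((not_le.1 hq).trans_le (Finset.mem_Ici.1 hs))
    rw [h1, h2]; ring

lemma Phi_bar_mul_sq (γ : Fin p → ℝ) {a b : Config p} {r : Fin p} (hr : IsPivot a r)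
    (hb : ∀ s, r < s → b.2 s = b.1 s) : Phi γ (bar a * b) ^ 2 = Phi γ (a * b) ^ 2 := by
  rw [Phi_bar_mul γ hr hb, neg_sq]

/-- The factor of `Q` that belongs to one layer. -/
def mixFactor (β : ℝ) (x y : ℤˣ) : ℂ :=
  (Real.cos β : ℂ) ^ (theta x + theta y) * (Real.sin β : ℂ) ^ (theta (-x) + theta (-y)) *
    Complex.I ^ ((theta (-x) : ℤ) - (theta (-y) : ℤ))

lemma Q_eq (β : Fin p → ℝ) (a : Config p) : Q β a = ∏ j, mixFactor (β j) (a.1 j) (a.2 j) := rfl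

lemma theta_neg_one : theta (-1) = 0 := by decide

lemma theta_one : theta 1 = 1 := by decide

/-- The off-diagonal values are `i sin β cos β` and its negative, because the two exponents of `i`
are opposite. -/
lemma mixFactor_neg (β : ℝ) (x : ℤˣ) : mixFactor β (-x) x = -mixFactor β x (-x) := by
  rcases Int.units_eq_one_or x with rfl | rfl <;>
    simp [mixFactor, theta_one, theta_neg_one]

lemma mixFactor_self_add (β : ℝ) : mixFactor β 1 1 + mixFactor β (-1) (-1) = 1 := by
  simp only [mixFactor, theta_one, theta_neg_one, neg_neg]
  simp only [Nat.cast_one, Nat.cast_zero, sub_self, zpow_zero, add_zero, pow_zero, mul_one,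
    one_mul]
  exact_mod_cast Real.cos_sq_add_sin_sq β

/-- Only the pivot layer is affected; there the two signs differ, so the flip exchanges the two
off-diagonal values of `mixFactor`. -/
lemma Q_bar (β : Fin p → ℝ) {a : Config p} {r : Fin p} (hr : IsPivot a r) :
    Q β (bar a) = -Q β a := by
  have h : ∀ j, mixFactor (β j) ((bar a).1 j) ((bar a).2 j) =
      mixFactor (β j) (a.1 j) (a.2 j) * if j = r then -1 else 1 := by
    intro j
    rw [bar_eq hr]
    simp only [Prod.fst_mul, Prod.snd_mul, Pi.mul_apply, Pi.mulSingle_apply]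
    split_ifs with hj
    · subst hj
      rw [hr.1]
      simp [mixFactor_neg]
    · simp
  rw [Q_eq, Q_eq, Finset.prod_congr rfl fun j _ => h j, Finset.prod_mul_distrib]
  simp

lemma mem_symmetricConfigs {a : Config p} : a ∈ symmetricConfigs p ↔ a.2 = a.1 := by
  simp [symmetricConfigs]

lemma mem_DAt {a : Config p} {r : Fin p} : a ∈ DAt r ↔ IsPivot a r ∧ ∏ s, a.1 s = 1 := by
  simp [DAt]

lemma prod_bar {a : Config p} {r : Fin p} (hr : IsPivot a r) :
    ∏ s, (bar a).1 s = -∏ s, a.1 s := by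
  rw [bar_eq hr]
  simp only [Prod.fst_mul, Pi.mul_apply, Finset.prod_mul_distrib, Pi.mulSingle_apply,
    Finset.prod_ite_eq', Finset.mem_univ, if_true, mul_neg, mul_one]

/-- A sum over all configurations, arranged in symmetric configurations and pairs
`{b, b̄}`. -/
lemma sum_config (H : Config p → ℂ) :
    ∑ a, H a = ∑ a ∈ symmetricConfigs p, H a + ∑ r, ∑ j ∈ DAt r, (H j + H (bar j)) := by
  have h1 : ∀ r : Fin p, ∑ j ∈ DAt r, (H j + H (bar j)) =
      ∑ a with IsPivot a r, H a := by
    intro r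
    rw [Finset.sum_add_distrib, ← Finset.sum_filter_add_sum_filter_not
      (Finset.univ.filter fun a : Config p => IsPivot a r) (fun a => ∏ s, a.1 s = 1) H]
    congr 1
    · exact Finset.sum_congr (by ext; simp [mem_DAt]) fun _ _ => rfl
    · refine Finset.sum_nbij' bar bar ?_ ?_ ?_ ?_ ?_
      · intro a ha
        obtain ⟨h, h'⟩ := mem_DAt.1 ha
        simp only [Finset.mem_filter, Finset.mem_univ, true_and]
        exact ⟨h.bar, by rw [prod_bar h, h']; decide⟩
      · intro a ha
        simp only [Finset.mem_filter, Finset.mem_univ, true_and] at ha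
        refine mem_DAt.2 ⟨ha.1.bar, ?_⟩
        rw [prod_bar ha.1, Int.units_ne_iff_eq_neg.1 ha.2, neg_neg]
      · intro a _; exact bar_bar a
      · intro a _; exact bar_bar a
      · intro a _; rfl
  rw [Finset.sum_congr rfl fun r _ => h1 r,
    ← Finset.sum_filter_add_sum_filter_not Finset.univ (fun a : Config p => a.2 = a.1) H]
  congr 1
  rw [← Finset.sum_biUnion]
  · refine Finset.sum_congr ?_ fun _ _ => rfl
    ext a
    simp only [Finset.mem_filter, Finset.mem_univ, true_and, Finset.mem_biUnion]
    constructor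
    · intro h
      exact (eq_or_exists_isPivot a).resolve_left h
    · rintro ⟨r, hr⟩ h
      have := hr.1
      rw [h] at this
      exact units_ne_neg_self _ this
  · intro r _ s _ hrs
    refine Finset.disjoint_left.2 fun a ha hb => hrs ?_
    exact (Finset.mem_filter.1 hb).2.unique (Finset.mem_filter.1 ha).2

/-- Source of the triangular structure: `b` can influence `c` only if `c` is asymmetric somewhere
beyond the pivot of `b`, since otherwise passing to `bar b` merely changes the sign of `Φ`. -/
lemma K_eq_zero (γ β : Fin p → ℝ) {b c : Config p} {r : Fin p} (hr : IsPivot b r)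
    (hc : ∀ s, r < s → c.2 s = c.1 s) : K γ β b c = 0 := by
  simp [K, Phi_bar_mul_sq γ hr hc]

/-- If the pivot of `c` is not beyond that of `b`, both sides vanish. Otherwise `b` and `bar b` are
symmetric beyond the pivot of `c`, and flipping `c` leaves both squares unchanged. -/
lemma K_bar_right (γ β : Fin p → ℝ) {b c : Config p} {r s : Fin p} (hr : IsPivot b r)
    (hs : IsPivot c s) : K γ β b (bar c) = K γ β b c := by
  rcases le_or_gt s r with h | h
  · rw [K_eq_zero γ β hr fun t ht => hs.bar.2 t (h.trans_lt ht),
      K_eq_zero γ β hr fun t ht => hs.2 t (h.trans_lt ht)]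
  · unfold K
    rw [Phi_mul_comm γ (bar b) (bar c), Phi_mul_comm γ b (bar c),
      Phi_bar_mul_sq γ hs fun t ht => hr.bar.2 t (h.trans ht),
      Phi_bar_mul_sq γ hs fun t ht => hr.2 t (h.trans ht),
      Phi_mul_comm γ c (bar b), Phi_mul_comm γ c b]

/-! ## The fixed point equation for `W` -/

/-- A triangular iteration ends in a solution of the corresponding fixed point equation. -/
lemma foldl_updateR (γ β : Fin p → ℝ) (l : List (Config p))
    (hl : l.Pairwise fun s t => K γ β t s = 0) (hd : ∀ s ∈ l, K γ β s s = 0) (j : Config p) :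
    l.foldl (updateR γ β) (fun _ => 1) j =
      Complex.exp (l.map fun s => l.foldl (updateR γ β) (fun _ => 1) s * K γ β s j).sum := by
  induction l using List.reverseRecOn generalizing j with
  | nil => simp
  | append_singleton l s ih =>
    rw [List.pairwise_append] at hl
    obtain ⟨h1, -, h2⟩ := hl
    have ih' := ih h1 fun t ht => hd t (by simp [ht])
    simp only [List.foldl_append, List.foldl_cons, List.foldl_nil, List.map_append,
      List.sum_append, List.map_cons, List.map_nil, List.sum_cons, List.sum_nil, add_zero]
    -- Processing `s` does not alter entries at elements already processed or at `s` itself, so the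
    -- values used in the exponents are the final ones.
    have h3 : ∀ t ∈ l, updateR γ β (l.foldl (updateR γ β) fun _ => 1) s t =
        l.foldl (updateR γ β) (fun _ => 1) t := by
      intro t ht
      simp [updateR, h2 t ht s (by simp)]
    have h4 : updateR γ β (l.foldl (updateR γ β) fun _ => 1) s s =
        l.foldl (updateR γ β) (fun _ => 1) s := by
      simp [updateR, hd s (by simp)]
    rw [List.map_congr_left (g := fun t => l.foldl (updateR γ β) (fun _ => 1) t * K γ β t j)
      fun t ht => by rw [h3 t ht], h4, Complex.exp_add, ← ih']
    rfl

/-- In the order of non-decreasing pivots a later element does not act on an earlier one, so the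
iteration solves `R_j = exp(∑_s R_s K_{s,j})`, whose right side is `Y_j` by definition. -/
lemma R_eq_Y (γ β : Fin p → ℝ) (j : Config p) : R γ β j = Y γ β j := by
  have hl : (DList p).Pairwise fun s t => K γ β t s = 0 := by
    unfold DList
    rw [List.pairwise_flatMap]
    constructor
    · intro r _
      refine List.pairwise_of_forall_mem_list ?_
      intro a ha b hb
      rw [Finset.mem_toList, mem_DAt] at ha hb
      exact K_eq_zero γ β hb.1 ha.1.2
    · refine (List.pairwise_lt_finRange p).imp ?_
      intro r s hrs a ha b hb
      rw [Finset.mem_toList, mem_DAt] at ha hb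
      exact K_eq_zero γ β hb.1 fun t ht => ha.1.2 t (hrs.trans ht)
  have hd : ∀ s ∈ DList p, K γ β s s = 0 := by
    intro s hs
    unfold DList at hs
    rw [List.mem_flatMap] at hs
    obtain ⟨r, _, hr⟩ := hs
    rw [Finset.mem_toList, mem_DAt] at hr
    exact K_eq_zero γ β hr.1 hr.1.2
  have h := foldl_updateR γ β (DList p) hl hd j
  have h' : ∀ G : Config p → ℂ, ((DList p).map G).sum = ∑ r, ∑ j ∈ DAt r, G j := by
    intro G
    unfold DList
    rw [List.map_flatMap, List.flatMap_def, List.sum_flatten, List.map_map, ← List.ofFn_eq_map,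
      List.sum_ofFn]
    simp
  rw [h'] at h
  exact h

/-- A product of two symmetric configurations is symmetric, and `Φ` vanishes on those. -/
lemma F_symm (γ β : Fin p → ℝ) {b : Config p} (hb : b.2 = b.1) : F γ β b = 1 := by
  unfold F
  rw [Finset.sum_eq_zero, mul_zero, Complex.exp_zero]
  intro a ha
  rw [mem_symmetricConfigs] at ha
  simp [Phi, ha, hb]

lemma F_bar (γ β : Fin p → ℝ) {b : Config p} {r : Fin p} (hr : IsPivot b r) :
    F γ β (bar b) = F γ β b := by
  unfold F
  congr 2
  refine Finset.sum_congr rfl fun a ha => ?_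
  rw [mem_symmetricConfigs] at ha
  rw [Phi_mul_comm γ a (bar b), Phi_bar_mul γ hr fun s _ => congrFun ha s, Phi_mul_comm γ a b]
  simp

lemma Y_symm (γ β : Fin p → ℝ) {b : Config p} (hb : b.2 = b.1) : Y γ β b = 1 := by
  unfold Y
  rw [Finset.sum_eq_zero, Complex.exp_zero]
  intro r _
  refine Finset.sum_eq_zero fun j hj => ?_
  rw [K_eq_zero γ β (mem_DAt.1 hj).1 fun s _ => congrFun hb s, mul_zero]

lemma Y_bar (γ β : Fin p → ℝ) {b : Config p} {r : Fin p} (hr : IsPivot b r) :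
    Y γ β (bar b) = Y γ β b := by
  unfold Y
  congr 1
  refine Finset.sum_congr rfl fun q _ => Finset.sum_congr rfl fun j hj => ?_
  rw [K_bar_right γ β (mem_DAt.1 hj).1 hr]

lemma W_symm (γ β : Fin p → ℝ) {b : Config p} (hb : b.2 = b.1) : W γ β b = Q β b := by
  simp [W, X, F_symm γ β hb, Y_symm γ β hb]

lemma W_bar (γ β : Fin p → ℝ) {b : Config p} {r : Fin p} (hr : IsPivot b r) :
    W γ β (bar b) = -W γ β b := by
  simp [W, X, F_bar γ β hr, Y_bar γ β hr, Q_bar β hr]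

/-- The mean field equation, together with the antisymmetry under the bar operation. -/
structure IsMeanField (γ β : Fin p → ℝ) (w : Config p → ℂ) : Prop where
  bar : ∀ a r, IsPivot a r → w (bar a) = -w a
  eqn : ∀ u, w u = Q β u * Complex.exp (-(1 / 2) * ∑ a, w a * ((Phi γ (a * u) : ℝ) : ℂ) ^ 2)

/-- Symmetric configurations have `W = Q` and yield the exponent of `F`. A pair `{j, bar j}` yields
`-½ W_j (Φ_{ju}² - Φ_{j̄u}²) = Y_j K_{j,u}`, which is a term in the exponent of `Y_u` because `R =
Y`. -/
lemma isMeanField_W (γ β : Fin p → ℝ) : IsMeanField γ β (W γ β) := by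
  refine ⟨fun a r hr => W_bar γ β hr, fun u => ?_⟩
  rw [sum_config, mul_add, Complex.exp_add, ← mul_assoc]
  unfold W
  congr 1
  · unfold X F
    congr 3
    refine Finset.sum_congr rfl fun a ha => ?_
    rw [mem_symmetricConfigs] at ha
    exact congrArg (· * _) (W_symm γ β ha).symm
  · rw [Y]
    congr 1
    rw [Finset.mul_sum]
    refine Finset.sum_congr rfl fun r _ => ?_
    rw [Finset.mul_sum]
    refine Finset.sum_congr rfl fun j hj => ?_
    have := W_bar γ β (mem_DAt.1 hj).1
    unfold W at this
    rw [this, R_eq_Y]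
    unfold K
    push_cast
    ring

end Configurations

/-! ## Adding a layer -/

section Layers

variable {p : ℕ}

/-- Append the signs of one more layer to a configuration. -/
def extend (c : Config p) (x y : ℤˣ) : Config (p + 1) :=
  (Fin.snoc (α := fun _ => ℤˣ) c.1 x, Fin.snoc (α := fun _ => ℤˣ) c.2 y)

/-- Every configuration with `p + 1` layers arises from one with `p` layers. -/
def extendEquiv (p : ℕ) : Config p × ℤˣ × ℤˣ ≃ Config (p + 1) where
  toFun t := extend t.1 t.2.1 t.2.2
  invFun a := ((Fin.init a.1, Fin.init a.2), a.1 (Fin.last p), a.2 (Fin.last p))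
  left_inv t := by simp [extend]
  right_inv a := by simp [extend]

lemma extend_surj (a : Config (p + 1)) : ∃ c x y, a = extend c x y :=
  ⟨_, _, _, ((extendEquiv p).apply_symm_apply a).symm⟩

lemma sum_extend {M : Type*} [AddCommMonoid M] (H : Config (p + 1) → M) :
    ∑ a, H a = ∑ c, ∑ x, ∑ y, H (extend c x y) := by
  rw [← (extendEquiv p).sum_comp, Fintype.sum_prod_type]
  simp only [Fintype.sum_prod_type]
  rfl

lemma sum_units {M : Type*} [AddCommMonoid M] (f : ℤˣ → M) : ∑ x, f x = f 1 + f (-1) := by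
  have : (Finset.univ : Finset ℤˣ) = {1, -1} := by decide
  rw [this, Finset.sum_pair (by decide)]

lemma starProd_snoc_castSucc (c : Fin p → ℤˣ) (x : ℤˣ) (r : Fin p) :
    starProd (Fin.snoc (α := fun _ => ℤˣ) c x) r.castSucc = starProd c r * sgn x := by
  have h : ∀ {q : ℕ} (f : Fin q → ℤˣ) (r : Fin q),
      ∏ s ∈ Finset.Ici r, f s = ∏ s, if r ≤ s then f s else 1 := by
    intro q f r
    rw [← Finset.prod_filter]
    exact Finset.prod_congr (by ext; simp) fun _ _ => rfl
  unfold starProd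
  rw [h, h, Fin.prod_univ_castSucc, ← sgn_mul]
  simp [Fin.le_last]

lemma starProd_snoc_last (c : Fin p → ℤˣ) (x : ℤˣ) :
    starProd (Fin.snoc (α := fun _ => ℤˣ) c x) (Fin.last p) = sgn x := by
  have : Finset.Ici (Fin.last p) = {Fin.last p} := by
    ext s; simp
  simp [starProd, this]

lemma Phi_extend (γ : Fin (p + 1) → ℝ) (c : Config p) (x y : ℤˣ) :
    Phi γ (extend c x y) = ∑ r, Fin.init γ r * (starProd c.1 r * sgn x - starProd c.2 r * sgn y) +
      γ (Fin.last p) * (sgn x - sgn y) := by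
  unfold Phi extend
  rw [Fin.sum_univ_castSucc]
  simp only [starProd_snoc_castSucc, starProd_snoc_last, Fin.init]

lemma Phi_extend_self (γ : Fin (p + 1) → ℝ) (c : Config p) (x : ℤˣ) :
    Phi γ (extend c x x) = sgn x * Phi (Fin.init γ) c := by
  rw [Phi_extend, sub_self, mul_zero, add_zero, Phi, Finset.mul_sum]
  exact Finset.sum_congr rfl fun r _ => by ring

lemma Phi_extend_neg (γ : Fin (p + 1) → ℝ) (c : Config p) (x y : ℤˣ) :
    Phi γ (extend c (-x) (-y)) = -Phi γ (extend c x y) := by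
  rw [Phi_extend, Phi_extend, neg_add, ← Finset.sum_neg_distrib, sgn_neg, sgn_neg]
  congr 1
  · exact Finset.sum_congr rfl fun r _ => by ring
  · ring

lemma extend_mul (c d : Config p) (x y x' y' : ℤˣ) :
    extend c x y * extend d x' y' = extend (c * d) (x * x') (y * y') := by
  unfold extend
  ext s <;> refine Fin.lastCases ?_ (fun s => ?_) s <;> simp

lemma Phi_extend_neg_mul (γ : Fin (p + 1) → ℝ) (c : Config p) (x y : ℤˣ) (u : Config (p + 1)) :
    Phi γ (extend c (-x) (-y) * u) = -Phi γ (extend c x y * u) := by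
  obtain ⟨d, x', y', rfl⟩ := extend_surj u
  rw [extend_mul, extend_mul, neg_mul, neg_mul, Phi_extend_neg]

lemma Q_extend (β : Fin (p + 1) → ℝ) (c : Config p) (x y : ℤˣ) :
    Q β (extend c x y) = Q (Fin.init β) c * mixFactor (β (Fin.last p)) x y := by
  rw [Q_eq, Q_eq, Fin.prod_univ_castSucc]
  simp [extend, Fin.init]

lemma IsPivot.extend {c : Config p} {r : Fin p} (hr : IsPivot c r) (x : ℤˣ) :
    IsPivot (extend c x x) r.castSucc := by
  unfold SKQAOA.extend
  refine ⟨by simpa using hr.1, fun s => ?_⟩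
  refine Fin.lastCases ?_ (fun s => ?_) s
  · simp
  · intro h
    simpa using hr.2 s (by simpa using h)

lemma bar_extend {c : Config p} {r : Fin p} (hr : IsPivot c r) (x : ℤˣ) :
    bar (extend c x x) = extend (bar c) x x := by
  rw [bar_eq (hr.extend x), bar_eq hr]
  have : (Pi.mulSingle r.castSucc (-1) : Fin (p + 1) → ℤˣ) =
      Fin.snoc (α := fun _ => ℤˣ) (Pi.mulSingle r (-1)) 1 := by
    funext s
    refine Fin.lastCases ?_ (fun s => ?_) s
    · simp
    · simp [Pi.mulSingle_apply]
  have h := extend_mul c (Pi.mulSingle r (-1), Pi.mulSingle r (-1)) x x 1 1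
  rw [mul_one] at h
  rw [← h, this]
  rfl

lemma isPivot_extend_last (c : Config p) (x : ℤˣ) :
    IsPivot (extend c x (-x)) (Fin.last p) := by
  unfold extend
  exact ⟨by simp, fun s hs => absurd hs (not_lt.2 (Fin.le_last s))⟩

lemma bar_extend_last (c : Config p) (x : ℤˣ) :
    bar (extend c x (-x)) = extend c (-x) x := by
  rw [bar_eq (isPivot_extend_last c x)]
  unfold extend
  ext s <;> refine Fin.lastCases ?_ (fun s => ?_) s <;>
    simp [Fin.castSucc_ne_last]

/-- Sum out the last layer. -/
def reduce (w : Config (p + 1) → ℂ) (c : Config p) : ℂ :=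
  w (extend c 1 1) + w (extend c (-1) (-1))

variable {γ β : Fin (p + 1) → ℝ} {w : Config (p + 1) → ℂ}

/-- Flipping both signs of the last layer preserves `Φ²`. Configurations whose last two signs differ
are exchanged by the bar operation and cancel; those whose last signs agree merge into `reduce w`.
-/
lemma IsMeanField.sum_eq (hw : IsMeanField γ β w) (u : Config (p + 1)) :
    ∑ a, w a * ((Phi γ (a * u) : ℝ) : ℂ) ^ 2 =
      ∑ c, reduce w c * ((Phi γ (extend c 1 1 * u) : ℝ) : ℂ) ^ 2 := by
  rw [sum_extend]
  refine Finset.sum_congr rfl fun c _ => ?_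
  simp only [sum_units]
  have h1 : w (extend c (-1) 1) = -w (extend c 1 (-1)) := by
    rw [← hw.bar _ _ (isPivot_extend_last c 1), bar_extend_last]
  have h2 := Phi_extend_neg_mul γ c 1 1 u
  have h3 := Phi_extend_neg_mul γ c 1 (-1) u
  rw [neg_neg] at h3
  rw [h1, h2, h3, reduce]
  push_cast
  ring

/-- The right side involves only the system with one layer less, so the implicit equation becomes an
explicit recursion in the number of layers. -/
lemma IsMeanField.eqn_reduce (hw : IsMeanField γ β w) (u : Config (p + 1)) :
    w u = Q β u * Complex.exp (-(1 / 2) *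
      ∑ c, reduce w c * ((Phi γ (extend c 1 1 * u) : ℝ) : ℂ) ^ 2) := by
  rw [← hw.sum_eq, ← hw.eqn]

/-- At `extend u x x` the exponent does not depend on `x`, and the two diagonal mixer weights add up
to `1`. -/
lemma IsMeanField.reduce (hw : IsMeanField γ β w) :
    IsMeanField (Fin.init γ) (Fin.init β) (reduce w) := by
  refine ⟨fun a r hr => ?_, fun u => ?_⟩
  · unfold SKQAOA.reduce
    rw [← bar_extend hr, ← bar_extend hr, hw.bar _ _ (hr.extend 1), hw.bar _ _ (hr.extend (-1))]
    ring
  · have h : ∀ x, w (extend u x x) = Q (Fin.init β) u * mixFactor (β (Fin.last p)) x x *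
        Complex.exp (-(1 / 2) *
          ∑ c, SKQAOA.reduce w c * ((Phi (Fin.init γ) (c * u) : ℝ) : ℂ) ^ 2) := by
      intro x
      rw [hw.eqn_reduce, Q_extend]
      congr 3
      refine Finset.sum_congr rfl fun c _ => ?_
      rw [extend_mul, one_mul, Phi_extend_self]
      push_cast
      rw [mul_pow, sq (sgn x : ℂ), ← Complex.ofReal_mul, sgn_mul_self, Complex.ofReal_one,
        one_mul]
    conv_lhs => rw [SKQAOA.reduce, h, h]
    rw [← add_mul, ← mul_add, mixFactor_self_add, mul_one]

end Layers

/-! ## Partition functions of fully connected systems -/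

/-- The weight of a site whose state is prescribed. -/
def mark {T : Type*} [DecidableEq T] (q : T → ℂ) (t s : T) : ℂ := if s = t then q s else 0

/-- Moves the prescribed sites to the front, where they can be summed out first; `latticeSum_perm`
makes the order immaterial. -/
lemma ofFn_extend_perm {T : Type*} [DecidableEq T] {n k : ℕ} (q : T → ℂ) (i : Fin k → Fin n)
    (hi : Function.Injective i)
    (t : Fin k → T) :
    (List.ofFn (Function.extend i (fun l => mark q (t l)) fun _ => q)).Perm
      ((List.ofFn t).map (mark q) ++ List.replicate (n - k) q) := by
  classical
  rw [← Multiset.coe_eq_coe]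
  set u := Function.extend i (fun l => mark q (t l)) fun _ => q with hu
  have h1 : ((List.ofFn u : List (T → ℂ)) : Multiset (T → ℂ)) =
      (Finset.univ : Finset (Fin n)).val.map u := by
    rw [List.ofFn_eq_map]; rfl
  have h2 : (((List.ofFn t).map (mark q) : List (T → ℂ)) : Multiset (T → ℂ)) =
      (Finset.univ : Finset (Fin k)).val.map fun l => mark q (t l) := by
    rw [List.ofFn_eq_map, List.map_map]; rfl
  rw [← Multiset.coe_add, h1, h2, ← Multiset.filter_add_not (fun j => j ∈ Set.range i)
    (Finset.univ : Finset (Fin n)).val, Multiset.map_add]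
  congr 1
  · have : (Finset.univ : Finset (Fin n)).val.filter (fun j => j ∈ Set.range i) =
        (Finset.univ : Finset (Fin k)).val.map i := by
      have := congrArg Finset.val (show (Finset.univ.filter fun j => j ∈ Set.range i) =
        (Finset.univ : Finset (Fin k)).map ⟨i, hi⟩ by ext; simp)
      exact this
    rw [this, Multiset.map_map]
    refine Multiset.map_congr rfl fun l _ => ?_
    simp [hu, hi.extend_apply]
  · rw [Multiset.coe_replicate, Multiset.eq_replicate]
    constructor
    · have h3 : (Finset.univ.filter fun j => j ∉ Set.range i).card = n - k := by
        have h4 : (Finset.univ.filter fun j => j ∉ Set.range i) =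
            ((Finset.univ : Finset (Fin k)).map ⟨i, hi⟩)ᶜ := by ext; simp
        rw [h4, Finset.card_compl]; simp
      rw [Multiset.card_map]
      exact h3
    · intro b hb
      obtain ⟨j, hj, rfl⟩ := Multiset.mem_map.1 hb
      rw [Multiset.mem_filter] at hj
      exact Function.extend_apply' _ _ _ hj.2

/-- The weight of a configuration of the whole system. -/
def gibbsWeight {T : Type*} (φ : T → T → ℂ) (q : T → ℂ) {n : ℕ} (s : Fin n → T) : ℂ :=
  (∏ j, q (s j)) * ∏ i, ∏ j ∈ Finset.Ioi i, φ (s i) (s j)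

/-- The interactions among sites in prescribed states. -/
def pairFactor {T : Type*} (φ : T → T → ℂ) : List T → ℂ
  | [] => 1
  | t :: L => (L.map (φ t)).prod * pairFactor φ L

section LatticeSum

variable {T : Type*} [Fintype T]

/-- The partition function of a fully connected system with pair interaction `φ` in an external
field `h`, with one site for every weight in the list. -/
def latticeSum (φ : T → T → ℂ) : (T → ℂ) → List (T → ℂ) → ℂ
  | _, [] => 1
  | h, u :: L => ∑ t, u t * h t * latticeSum φ (fun s => h s * φ t s) L

variable {φ : T → T → ℂ}

@[simp] lemma latticeSum_nil (h : T → ℂ) : latticeSum φ h [] = 1 := rfl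

lemma latticeSum_cons (h u : T → ℂ) (L : List (T → ℂ)) :
    latticeSum φ h (u :: L) = ∑ t, u t * h t * latticeSum φ (fun s => h s * φ t s) L := rfl

lemma latticeSum_perm (hφ : ∀ s t, φ s t = φ t s) {L L' : List (T → ℂ)} (hL : L.Perm L')
    (h : T → ℂ) : latticeSum φ h L = latticeSum φ h L' := by
  induction hL generalizing h with
  | nil => rfl
  | cons u _ ih => simp only [latticeSum_cons, ih]
  | swap u v L =>
    simp only [latticeSum_cons, Finset.mul_sum]
    rw [Finset.sum_comm]
    refine Finset.sum_congr rfl fun s _ => Finset.sum_congr rfl fun t _ => ?_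
    have : (fun r => h r * φ t r * φ s r) = fun r => h r * φ s r * φ t r := by
      funext r; ring
    rw [this, hφ t s]
    ring
  | trans _ _ ih1 ih2 => rw [ih1, ih2]

lemma latticeSum_add (h u v : T → ℂ) (L L' : List (T → ℂ)) :
    latticeSum φ h (L ++ (fun t => u t + v t) :: L') =
      latticeSum φ h (L ++ u :: L') + latticeSum φ h (L ++ v :: L') := by
  induction L generalizing h with
  | nil => simp [latticeSum_cons, add_mul, Finset.sum_add_distrib]
  | cons x L ih => simp [latticeSum_cons, ih, mul_add, Finset.sum_add_distrib]

/-- An external field may be absorbed into the weights of the sites, so the field of prescribed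
sites becomes a change of weight that can be expanded. -/
lemma latticeSum_field (g h : T → ℂ) (L : List (T → ℂ)) :
    latticeSum φ (fun s => g s * h s) L = latticeSum φ g (L.map fun u s => u s * h s) := by
  induction L generalizing g with
  | nil => rfl
  | cons u L ih =>
    simp only [List.map_cons, latticeSum_cons]
    refine Finset.sum_congr rfl fun t _ => ?_
    rw [← ih]
    have : (fun s => g s * h s * φ t s) = fun s => g s * φ t s * h s := by
      funext s; ring
    rw [this]
    ring

/-- The binomial expansion of a partition function of equal sites. -/
lemma latticeSum_replicate_add (hφ : ∀ s t, φ s t = φ t s) (h u v : T → ℂ) (m : ℕ) :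
    latticeSum φ h (List.replicate m fun t => u t + v t) =
      ∑ k ∈ Finset.range (m + 1), (m.choose k : ℂ) *
        latticeSum φ h (List.replicate k v ++ List.replicate (m - k) u) := by
  -- The sites already expanded, `i` of one kind and `j` of the other, are carried along so that
  -- Pascal's rule closes the induction.
  have key : ∀ m i j, latticeSum φ h (List.replicate m (fun t => u t + v t) ++
      (List.replicate i v ++ List.replicate j u)) =
      ∑ ab ∈ Finset.HasAntidiagonal.antidiagonal m, (m.choose ab.1 : ℂ) *
        latticeSum φ h (List.replicate (i + ab.1) v ++ List.replicate (j + ab.2) u) := by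
    intro m
    induction m with
    | zero => simp
    | succ m ih =>
      intro i j
      rw [Finset.sum_antidiagonal_choose_succ_mul fun a b =>
        latticeSum φ h (List.replicate (i + a) v ++ List.replicate (j + b) u)]
      have h1 := ih (i + 1) j
      have h2 := ih i (j + 1)
      have h3 : latticeSum φ h (List.replicate (m + 1) (fun t => u t + v t) ++
          (List.replicate i v ++ List.replicate j u)) =
          latticeSum φ h (List.replicate m (fun t => u t + v t) ++
            (List.replicate i v ++ List.replicate (j + 1) u)) +
          latticeSum φ h (List.replicate m (fun t => u t + v t) ++
            (List.replicate (i + 1) v ++ List.replicate j u)) := by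
        rw [List.replicate_succ', List.append_assoc, List.singleton_append, latticeSum_add]
        congr 1
        refine latticeSum_perm hφ (List.Perm.append_left _ ?_) h
        rw [List.replicate_succ]
        exact List.perm_middle.symm
      rw [h3, h1, h2]
      congr 1
      · exact Finset.sum_congr rfl fun ab _ => by rw [add_right_comm j, add_assoc j]
      · refine Finset.sum_congr rfl fun ab hab => ?_
        rw [Nat.choose_symm_of_eq_add (Finset.HasAntidiagonal.mem_antidiagonal.1 hab).symm,
          add_right_comm i, add_assoc i]
  have := key m 0 0
  simp only [List.replicate_zero, List.append_nil, zero_add] at this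
  rw [this, Finset.Nat.sum_antidiagonal_eq_sum_range_succ_mk]

lemma latticeSum_ofFn (n : ℕ) (h : T → ℂ) (u : Fin n → T → ℂ) :
    latticeSum φ h (List.ofFn u) =
      ∑ s : Fin n → T, (∏ j, u j (s j) * h (s j)) * ∏ i, ∏ j ∈ Finset.Ioi i, φ (s i) (s j) := by
  induction n generalizing h with
  | zero => simp
  | succ n ih =>
    rw [← (Fin.consEquiv fun _ : Fin (n + 1) => T).sum_comp, Fintype.sum_prod_type,
      List.ofFn_succ, latticeSum_cons]
    refine Finset.sum_congr rfl fun t _ => ?_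
    rw [ih, Finset.mul_sum]
    refine Finset.sum_congr rfl fun s _ => ?_
    simp only [Fin.consEquiv_apply, Fin.prod_univ_succ, Fin.cons_zero,
      Fin.cons_succ, Fin.prod_Ioi_zero, Fin.prod_Ioi_succ, Finset.prod_mul_distrib]
    ring

variable [DecidableEq T]

lemma latticeSum_mark (q h : T → ℂ) (t : T) (L : List (T → ℂ)) :
    latticeSum φ h (mark q t :: L) = q t * h t * latticeSum φ (fun s => h s * φ t s) L := by
  rw [latticeSum_cons, Finset.sum_eq_single t]
  · simp [mark]
  · intro s _ hs; simp [mark, hs]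
  · simp

/-- Each perturbed site is resolved into its possible states: the perturbation `e` comes out as a
scalar and a site of prescribed state is left behind. -/
lemma latticeSum_replicate_append (q e h : T → ℂ) (k : ℕ) (R : List (T → ℂ)) :
    latticeSum φ h (List.replicate k (fun t => q t * e t) ++ R) =
      ∑ t : Fin k → T, (∏ i, e (t i)) *
        latticeSum φ h ((List.ofFn t).map (mark q) ++ R) := by
  induction k generalizing h with
  | zero => simp
  | succ k ih =>
    rw [← (Fin.consEquiv fun _ : Fin (k + 1) => T).sum_comp, Fintype.sum_prod_type,
      List.replicate_succ, List.cons_append, latticeSum_cons]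
    refine Finset.sum_congr rfl fun t _ => ?_
    rw [ih, Finset.mul_sum]
    refine Finset.sum_congr rfl fun s _ => ?_
    simp only [Fin.consEquiv_apply, Fin.prod_univ_succ, List.ofFn_succ, Fin.cons_zero,
      Fin.cons_succ, List.map_cons, List.cons_append, latticeSum_mark]
    ring

/-- Prescribed sites leave three traces: their own weights and fields, their mutual interactions,
and the field that they exert on the rest. -/
lemma latticeSum_map_mark_append (q h : T → ℂ) (L : List T) (R : List (T → ℂ)) :
    latticeSum φ h (L.map (mark q) ++ R) = (L.map q).prod * (L.map h).prod * pairFactor φ L *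
      latticeSum φ (fun s => h s * (L.map fun t => φ t s).prod) R := by
  induction L generalizing h with
  | nil => simp [pairFactor]
  | cons t L ih =>
    rw [List.map_cons, List.cons_append, latticeSum_mark, ih]
    simp only [List.map_cons, List.prod_cons, pairFactor, List.prod_map_mul, mul_assoc]
    ring

/-- Averages of functions of a few sites in terms of marginals. -/
lemma sum_gibbsWeight (hφ : ∀ s t, φ s t = φ t s) {n k : ℕ} (q : T → ℂ) (i : Fin k → Fin n)
    (hi : Function.Injective i) (G : (Fin k → T) → ℂ) :
    ∑ s : Fin n → T, G (s ∘ i) * gibbsWeight φ q s =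
      ∑ t : Fin k → T, G t * latticeSum φ (fun _ => 1)
        ((List.ofFn t).map (mark q) ++ List.replicate (n - k) q) := by
  have h1 : ∀ t : Fin k → T, latticeSum φ (fun _ => 1)
      ((List.ofFn t).map (mark q) ++ List.replicate (n - k) q) =
      ∑ s : Fin n → T, if s ∘ i = t then gibbsWeight φ q s else 0 := by
    intro t
    rw [← latticeSum_perm hφ (ofFn_extend_perm q i hi t), latticeSum_ofFn]
    refine Finset.sum_congr rfl fun s _ => ?_
    split_ifs with hs
    · unfold gibbsWeight
      congr 1
      refine Finset.prod_congr rfl fun j _ => ?_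
      by_cases hj : ∃ l, i l = j
      · obtain ⟨l, rfl⟩ := hj
        rw [hi.extend_apply]
        simp [mark, ← hs]
      · rw [Function.extend_apply' _ _ _ hj, mul_one]
    · obtain ⟨l, hl⟩ := Function.ne_iff.1 hs
      rw [Finset.prod_eq_zero (Finset.mem_univ (i l)), zero_mul]
      rw [hi.extend_apply]
      simp only [mark, mul_one]
      exact if_neg hl
  simp only [h1, Finset.mul_sum]
  rw [Finset.sum_comm]
  refine Finset.sum_congr rfl fun s _ => ?_
  simp

end LatticeSum

/-! ## Single-site histories -/

section Sites

variable {p : ℕ}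

/-- The history of one qubit: the configuration of its sign changes and its final sign. -/
abbrev Site (p : ℕ) : Type := Config p × ℤˣ

/-- The weight of a single-site history. -/
def siteWeight (β : Fin p → ℝ) (t : Site p) : ℂ := Q β t.1 / 2

/-- The phase that two histories pick up per unit of coupling. -/
def phase (γ : Fin p → ℝ) (s t : Site p) : ℝ := sgn s.2 * sgn t.2 * Phi γ (s.1 * t.1)

lemma phase_comm (γ : Fin p → ℝ) (s t : Site p) : phase γ s t = phase γ t s := by
  rw [phase, phase, Phi_mul_comm]; ring

/-- Functions of a site that do not see the spin after the last layer. -/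
def IgnoresFinal {M : Type*} (f : Site (p + 1) → M) : Prop :=
  ∀ c x y z, f (extend c (-x) (-y), -z) = f (extend c x y, z)

/-- The history with `p + 1` layers in which nothing happens in the last layer. -/
def lift (t : Site p) : Site (p + 1) := (extend t.1 1 1, t.2)

lemma phase_lift (γ : Fin (p + 1) → ℝ) (s t : Site p) :
    phase γ (lift s) (lift t) = phase (Fin.init γ) s t := by
  simp [phase, lift, extend_mul, Phi_extend_self]

/-- Phases depend on a site only through the spins `z a*_r` and `z a*_{-r}` seen by the cost layers.
Flipping both last-layer signs together with the final sign fixes all of these. -/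
lemma ignoresFinal_phase (γ : Fin (p + 1) → ℝ) (t : Site (p + 1)) :
    IgnoresFinal fun s => phase γ s t := by
  intro c x y z
  simp only [phase, Phi_extend_neg_mul, sgn_neg]
  ring

lemma mixFactor_ne_add (β : ℝ) : mixFactor β 1 (-1) + mixFactor β (-1) 1 = 0 := by
  rw [mixFactor_neg, add_neg_cancel]

/-- Unitarity of the mixer on one qubit. -/
lemma sum_siteWeight_mul (β : Fin (p + 1) → ℝ) {f : Site (p + 1) → ℂ} (hf : IgnoresFinal f) :
    ∑ t, siteWeight β t * f t = ∑ t, siteWeight (Fin.init β) t * f (lift t) := by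
  rw [show ∑ t, siteWeight β t * f t = ∑ a, ∑ z, siteWeight β (a, z) * f (a, z) from
      Fintype.sum_prod_type _, sum_extend,
    show ∑ t, siteWeight (Fin.init β) t * f (lift t) = ∑ c, ∑ z,
      siteWeight (Fin.init β) (c, z) * f (lift (c, z)) from Fintype.sum_prod_type _]
  refine Finset.sum_congr rfl fun c _ => ?_
  have h1 := hf c 1 1 1
  have h2 := hf c 1 1 (-1)
  have h3 := hf c 1 (-1) 1
  have h4 := hf c 1 (-1) (-1)
  simp only [neg_neg] at h1 h2 h3 h4
  simp only [sum_units, siteWeight, Q_extend, lift, h1, h2, h3, h4]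
  have e1 := mixFactor_self_add (β (Fin.last p))
  have e2 := mixFactor_ne_add (β (Fin.last p))
  -- Only representatives with first last-layer sign `1` remain. Equal signs carry total mixer
  -- weight `1` (`e1`), opposite signs total weight `0` (`e2`).
  linear_combination
    (Q (Fin.init β) c / 2 * (f (extend c 1 1, 1) + f (extend c 1 1, -1))) * e1 +
    (Q (Fin.init β) c / 2 * (f (extend c 1 (-1), 1) + f (extend c 1 (-1), -1))) * e2

/-- Partition functions that do not see the final spins reduce to those of one layer less. -/
lemma latticeSum_lift (β : Fin (p + 1) → ℝ) {φ' : Site (p + 1) → Site (p + 1) → ℂ}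
    {φ : Site p → Site p → ℂ} (hφ : ∀ s t, φ' (lift s) (lift t) = φ s t)
    (h1 : IgnoresFinal φ') (h2 : ∀ s, IgnoresFinal (φ' s))
    (L : List (Site (p + 1) → ℂ)) (hL : ∀ f ∈ L, IgnoresFinal f) (h : Site (p + 1) → ℂ)
    (hh : IgnoresFinal h) :
    latticeSum φ' h (L.map fun f t => siteWeight β t * f t) =
      latticeSum φ (fun t => h (lift t))
        (L.map fun f t => siteWeight (Fin.init β) t * f (lift t)) := by
  induction L generalizing h with
  | nil => rfl
  | cons f L ih =>
    simp only [List.map_cons, latticeSum_cons]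
    have hf := hL f (by simp)
    have key := sum_siteWeight_mul β (f := fun t => f t * h t * latticeSum φ'
      (fun s => h s * φ' t s) (L.map fun f t => siteWeight β t * f t)) (by
        intro c x y z
        simp only [hf c x y z, hh c x y z, h1 c x y z])
    simp only [← mul_assoc] at key
    rw [key]
    refine Finset.sum_congr rfl fun t _ => ?_
    rw [ih (fun g hg => hL g (by simp [hg])) _ (by
      intro c x y z
      simp only [hh c x y z, h2 _ c x y z])]
    simp only [hφ]

end Sites

/-! ## Fourier transforms of the law of a coupling -/

section CharFun

variable {ν : Measure ℝ}

/-- `E[J^k exp(i t J)]`. -/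
def fourierMoment (ν : Measure ℝ) (k : ℕ) (t : ℝ) : ℂ :=
  ∫ x, (x : ℂ) ^ k * Complex.exp (t * x * Complex.I) ∂ν

lemma fourierMoment_zero (t : ℝ) : fourierMoment ν 0 t = charFun ν t := by
  simp [fourierMoment, charFun_apply_real]

lemma norm_exp_mul_I (t x : ℝ) : ‖Complex.exp (t * x * Complex.I)‖ = 1 := by
  exact_mod_cast Complex.norm_exp_ofReal_mul_I (t * x)

lemma integrable_pow_mul_exp [IsProbabilityMeasure ν] (hν : MemLp id 2 ν) {k : ℕ} (hk : k ≤ 2)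
    (t : ℝ) : Integrable (fun x : ℝ => (x : ℂ) ^ k * Complex.exp (t * x * Complex.I)) ν := by
  have h1 : MemLp (id : ℝ → ℝ) k ν := hν.mono_exponent (by exact_mod_cast hk)
  have h2 : Integrable (fun x : ℝ => ‖x‖ ^ k) ν := by
    rcases Nat.eq_zero_or_pos k with rfl | hk
    · simp
    · exact h1.integrable_norm_pow (by omega)
  refine h2.mono' ?_ (ae_of_all _ fun x => ?_)
  · exact (by fun_prop : Continuous fun x : ℝ =>
      (x : ℂ) ^ k * Complex.exp (t * x * Complex.I)).aestronglyMeasurable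
  · simp [norm_exp_mul_I]

/-- The Taylor bound serves for `|x| ≤ 1`. For larger `x` the crude bound `2 + |x|` is at most
`3x²`, whence the constant. -/
lemma norm_exp_I_sub_one_sub_le (x : ℝ) :
    ‖Complex.exp (x * Complex.I) - 1 - x * Complex.I‖ ≤ 3 * x ^ 2 := by
  rcases le_or_gt |x| 1 with h | h
  · have := Complex.norm_exp_sub_one_sub_id_le (x := x * Complex.I) (by simpa using h)
    refine this.trans ?_
    simp
    nlinarith [sq_nonneg x]
  · have h1 : ‖Complex.exp (x * Complex.I) - 1 - x * Complex.I‖ ≤ 1 + 1 + |x| := by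
      refine (norm_sub_le _ _).trans (add_le_add ((norm_sub_le _ _).trans ?_) ?_)
      · simp [Complex.norm_exp_ofReal_mul_I]
      · simp
    nlinarith [sq_abs x]

/-- The linear term has mean zero and may be subtracted under the integral, so two moments suffice
for a quadratic bound valid at every `t`. -/
lemma norm_charFun_sub_one_le [IsProbabilityMeasure ν] (hν : MemLp id 2 ν)
    (hmean : ∫ x, x ∂ν = 0) (hvar : ∫ x, x ^ 2 ∂ν = 1) (t : ℝ) :
    ‖charFun ν t - 1‖ ≤ 3 * t ^ 2 := by
  have h0 := integrable_pow_mul_exp hν (k := 0) (by norm_num) t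
  have h1 := integrable_pow_mul_exp hν (k := 1) (by norm_num) 0
  simp only [pow_zero, one_mul] at h0
  simp only [pow_one, Complex.ofReal_zero, zero_mul, Complex.exp_zero, mul_one] at h1
  have h2 : charFun ν t - 1 =
      ∫ x, (Complex.exp (t * x * Complex.I) - 1 - x * (t * Complex.I)) ∂ν := by
    have h3 : Integrable (fun x : ℝ => Complex.exp (t * x * Complex.I) - 1) ν :=
      h0.sub (integrable_const _)
    rw [integral_sub h3 (h1.mul_const _), integral_sub h0 (integrable_const _), integral_mul_const,
      integral_complex_ofReal, hmean,
      charFun_apply_real]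
    simp
  have h3 : ∫ x, 3 * t ^ 2 * x ^ 2 ∂ν = 3 * t ^ 2 := by
    rw [integral_const_mul, hvar, mul_one]
  rw [h2, ← h3]
  refine norm_integral_le_of_norm_le (hν.integrable_sq.const_mul _) (ae_of_all _ fun x => ?_)
  have := norm_exp_I_sub_one_sub_le (t * x)
  push_cast at this
  rw [show (x : ℂ) * (t * Complex.I) = t * x * Complex.I by ring]
  refine this.trans (le_of_eq ?_)
  ring

lemma norm_fourierMoment_one_le [IsProbabilityMeasure ν] (hν : MemLp id 2 ν)
    (hmean : ∫ x, x ∂ν = 0) (hvar : ∫ x, x ^ 2 ∂ν = 1) (t : ℝ) :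
    ‖fourierMoment ν 1 t‖ ≤ |t| := by
  have h0 := integrable_pow_mul_exp hν (k := 1) (by norm_num) t
  have h1 := integrable_pow_mul_exp hν (k := 1) (by norm_num) 0
  simp only [pow_one] at h0
  simp only [pow_one, Complex.ofReal_zero, zero_mul, Complex.exp_zero, mul_one] at h1
  have h2 : fourierMoment ν 1 t = ∫ x : ℝ, (x * Complex.exp (t * x * Complex.I) - x : ℂ) ∂ν := by
    rw [integral_sub h0 h1, integral_complex_ofReal, hmean, fourierMoment]
    simp
  have h3 : ∫ x, |t| * x ^ 2 ∂ν = |t| := by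
    rw [integral_const_mul, hvar, mul_one]
  rw [h2, ← h3]
  refine norm_integral_le_of_norm_le (hν.integrable_sq.const_mul _) (ae_of_all _ fun x => ?_)
  have h4 : ‖Complex.exp (Complex.I * (t * x : ℝ)) - 1‖ ≤ ‖t * x‖ :=
    Real.norm_exp_I_mul_ofReal_sub_one_le
  rw [show (x : ℂ) * Complex.exp (t * x * Complex.I) - x =
    x * (Complex.exp (Complex.I * (t * x : ℝ)) - 1) by
      push_cast; rw [mul_comm Complex.I]; ring, norm_mul, Complex.norm_real]
  calc ‖x‖ * ‖Complex.exp (Complex.I * (t * x : ℝ)) - 1‖ ≤ ‖x‖ * ‖t * x‖ := by gcongr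
    _ = |t| * id x ^ 2 := by
      rw [norm_mul, Real.norm_eq_abs, Real.norm_eq_abs, id, ← sq_abs x]; ring

lemma norm_fourierMoment_two_le (hvar : ∫ x, x ^ 2 ∂ν = 1) (t : ℝ) :
    ‖fourierMoment ν 2 t‖ ≤ 1 := by
  rw [← hvar]
  refine (norm_integral_le_integral_norm _).trans (le_of_eq ?_)
  simp [norm_exp_mul_I]

lemma tendsto_div_sqrt (x : ℝ) : Tendsto (fun n : ℕ => x / √n) atTop (𝓝 0) :=
  Tendsto.const_div_atTop (Real.tendsto_sqrt_atTop.comp tendsto_natCast_atTop_atTop) x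

lemma tendsto_sqrt_pow_mul_of_isLittleO {r : ℝ → ℂ} {k : ℕ}
    (hr : r =o[𝓝 0] fun t : ℝ => t ^ k) (x : ℝ) :
    Tendsto (fun n : ℕ => ((√n : ℝ) : ℂ) ^ k * r (x / √n)) atTop (𝓝 0) := by
  have h1 := hr.comp_tendsto (tendsto_div_sqrt x)
  have h0 : (fun n : ℕ => ((√n : ℝ) : ℂ) ^ k) =O[atTop] fun n : ℕ => (√n : ℝ) ^ k :=
    Asymptotics.IsBigO.of_bound 1 (Eventually.of_forall fun n => by simp)
  have h2 := h0.mul_isLittleO h1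
  have h3 : (fun n : ℕ => (√n : ℝ) ^ k * ((fun t : ℝ => t ^ k) ∘ fun n : ℕ => x / √n) n)
      =O[atTop] fun _ => (1 : ℝ) := by
    refine Asymptotics.IsBigO.of_bound |x ^ k| ?_
    filter_upwards [eventually_gt_atTop 0] with n hn
    have : √(n : ℝ) ≠ 0 := (Real.sqrt_pos.2 (by exact_mod_cast hn)).ne'
    simp only [Function.comp]
    rw [div_pow, mul_div_cancel₀ _ (pow_ne_zero _ this)]
    simp
  exact (Asymptotics.isLittleO_one_iff ℝ).1 (h2.trans_isBigO h3)

lemma tendsto_charFun_sub_one [IsProbabilityMeasure ν]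
    (hmean : ∫ x, x ∂ν = 0) (hvar : ∫ x, x ^ 2 ∂ν = 1) (x : ℝ) :
    Tendsto (fun n : ℕ => (n : ℂ) * (charFun ν (x / √n) - 1)) atTop (𝓝 (-(x : ℂ) ^ 2 / 2)) := by
  have h := taylor_charFun_two (P := ν) (X := id) aemeasurable_id hmean hvar
  rw [Measure.map_id] at h
  have h1 := (tendsto_sqrt_pow_mul_of_isLittleO h x).add_const (-(x : ℂ) ^ 2 / 2)
  rw [zero_add] at h1
  refine h1.congr' ?_
  filter_upwards [eventually_gt_atTop 0] with n hn
  have h2 : ((√(n : ℝ) : ℝ) : ℂ) ^ 2 = n := by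
    rw [← Complex.ofReal_pow, Real.sq_sqrt (Nat.cast_nonneg n)]; simp
  have h3 : (n : ℂ) ≠ 0 := by exact_mod_cast hn.ne'
  push_cast
  rw [div_pow, h2]
  field_simp
  ring

/-- The first Fourier moment is `-i` times the derivative of the characteristic function. It
vanishes at `0` and has derivative `i` there, by the variance condition. -/
lemma tendsto_fourierMoment_one [IsProbabilityMeasure ν] (hν : MemLp id 2 ν)
    (hmean : ∫ x, x ∂ν = 0) (hvar : ∫ x, x ^ 2 ∂ν = 1) (x : ℝ) :
    Tendsto (fun n : ℕ => ((√n : ℝ) : ℂ) * fourierMoment ν 1 (x / √n)) atTop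
      (𝓝 (Complex.I * x)) := by
  have hd : ∀ t, deriv (charFun ν) t = Complex.I * fourierMoment ν 1 t := by
    intro t
    have := iteratedDeriv_charFun (μ := ν) (n := 1) (t := t)
      (hν.mono_exponent (by norm_num))
    rw [iteratedDeriv_one] at this
    rw [this, fourierMoment, pow_one]
  have h2 : deriv (deriv (charFun ν)) 0 = -1 := by
    have := iteratedDeriv_charFun_zero (μ := ν) (n := 2) (by exact_mod_cast hν)
    rw [iteratedDeriv_succ, iteratedDeriv_one, hvar] at this
    simpa using this
  have hc : ContDiff ℝ 2 (charFun ν) := by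
    exact_mod_cast contDiff_charFun (μ := ν) (n := 2) (by exact_mod_cast hν)
  have h3 : DifferentiableAt ℝ (deriv (charFun ν)) 0 :=
    ((contDiff_succ_iff_deriv (n := 1)).1
      (by simpa [one_add_one_eq_two] using hc)).2.2.differentiable (by norm_num) 0
  have h4 : HasDerivAt (fourierMoment ν 1) Complex.I 0 := by
    have h5 := (h3.hasDerivAt.const_mul (-Complex.I))
    rw [h2] at h5
    have h6 : fourierMoment ν 1 = fun t => -Complex.I * deriv (charFun ν) t := by
      funext t
      rw [hd, ← mul_assoc]
      simp
    rw [h6]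
    simpa using h5
  have h5 : fourierMoment ν 1 0 = 0 := by
    have := norm_fourierMoment_one_le hν hmean hvar 0
    simpa using this
  rw [hasDerivAt_iff_isLittleO] at h4
  simp only [h5, sub_zero] at h4
  have h6' : (fun t : ℝ => fourierMoment ν 1 t - t * Complex.I) =o[𝓝 0] fun t : ℝ => t ^ 1 := by
    simpa using h4
  have h6 := (tendsto_sqrt_pow_mul_of_isLittleO h6' x).add_const (Complex.I * x)
  rw [zero_add] at h6
  refine h6.congr' ?_
  filter_upwards [eventually_gt_atTop 0] with n hn
  have h7 : ((√(n : ℝ) : ℝ) : ℂ) ≠ 0 := by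
    exact_mod_cast (Real.sqrt_pos.2 (by exact_mod_cast hn : (0 : ℝ) < n)).ne'
  push_cast
  field_simp
  ring

end CharFun

/-! ## Marginals of the averaged system -/

section ListProducts

variable {α : Type*}

lemma norm_list_prod_map_le {f : α → ℂ} {A : ℝ} (hA : 0 ≤ A) (hf : ∀ x, ‖f x‖ ≤ A)
    (L : List α) : ‖(L.map f).prod‖ ≤ A ^ L.length := by
  induction L with
  | nil => simp
  | cons x L ih =>
    rw [List.map_cons, List.prod_cons, norm_mul, List.length_cons, pow_succ']
    exact mul_le_mul (hf x) ih (norm_nonneg _) hA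

lemma norm_list_prod_map_sub_one_le {f : α → ℂ} {δ : ℝ} (h1 : ∀ x, ‖f x‖ ≤ 1)
    (h2 : ∀ x, ‖f x - 1‖ ≤ δ) (L : List α) : ‖(L.map f).prod - 1‖ ≤ L.length * δ := by
  induction L with
  | nil => simp
  | cons x L ih =>
    rw [List.map_cons, List.prod_cons, List.length_cons,
      show f x * (L.map f).prod - 1 = f x * ((L.map f).prod - 1) + (f x - 1) by ring]
    refine (norm_add_le _ _).trans ?_
    rw [norm_mul]
    have := mul_le_mul (h1 x) ih (norm_nonneg _) zero_le_one
    push_cast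
    linarith [h2 x]

lemma norm_pairFactor_le {φ : α → α → ℂ} (h : ∀ s t, ‖φ s t‖ ≤ 1) (L : List α) :
    ‖pairFactor φ L‖ ≤ 1 := by
  induction L with
  | nil => simp [pairFactor]
  | cons t L ih =>
    rw [pairFactor, norm_mul]
    have := norm_list_prod_map_le zero_le_one (h t) L
    rw [one_pow] at this
    exact mul_le_one₀ this (norm_nonneg _) ih

lemma tendsto_list_prod_map {f : ℕ → α → ℂ} {g : α → ℂ}
    (h : ∀ x, Tendsto (fun n => f n x) atTop (𝓝 (g x))) (L : List α) :
    Tendsto (fun n => (L.map (f n)).prod) atTop (𝓝 (L.map g).prod) := by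
  induction L with
  | nil => simp
  | cons x L ih => simpa using (h x).mul ih

lemma tendsto_pairFactor {φ : ℕ → α → α → ℂ}
    (h : ∀ s t, Tendsto (fun n => φ n s t) atTop (𝓝 1)) (L : List α) :
    Tendsto (fun n => pairFactor (φ n) L) atTop (𝓝 1) := by
  induction L with
  | nil => simp [pairFactor]
  | cons t L ih =>
    have := (tendsto_list_prod_map (h t) L).mul ih
    simpa [pairFactor] using this

lemma tendsto_natCast_mul_list_prod_map_sub_one {f : ℕ → α → ℂ} {g : α → ℂ}
    (h1 : ∀ x, Tendsto (fun n => f n x) atTop (𝓝 1))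
    (h2 : ∀ x, Tendsto (fun n : ℕ => (n : ℂ) * (f n x - 1)) atTop (𝓝 (g x))) (L : List α) :
    Tendsto (fun n : ℕ => (n : ℂ) * ((L.map (f n)).prod - 1)) atTop (𝓝 (L.map g).sum) := by
  induction L with
  | nil => simp
  | cons x L ih =>
    have := ((h1 x).mul ih).add (h2 x)
    simp only [List.map_cons, List.prod_cons, List.sum_cons]
    rw [one_mul, add_comm] at this
    refine this.congr fun n => ?_
    ring

lemma tendsto_sub_natCast_div (d : ℕ) :
    Tendsto (fun n : ℕ => ((n - d : ℕ) : ℝ) / n) atTop (𝓝 1) := by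
  have h : Tendsto (fun n : ℕ => 1 - (d : ℝ) / n) atTop (𝓝 (1 - 0)) :=
    tendsto_const_nhds.sub (tendsto_const_div_atTop_nhds_zero_nat _)
  rw [sub_zero] at h
  refine h.congr' ?_
  filter_upwards [eventually_gt_atTop d] with n hn
  have : (n : ℝ) ≠ 0 := by exact_mod_cast (by omega : n ≠ 0)
  rw [Nat.cast_sub hn.le]
  field_simp

lemma tendsto_choose_div_pow (d k : ℕ) :
    Tendsto (fun n : ℕ => ((n - d).choose k : ℝ) / n ^ k) atTop (𝓝 (1 / k.factorial)) := by
  have h : Tendsto (fun n : ℕ => (∏ i ∈ Finset.range k, ((n - (d + i) : ℕ) : ℝ) / n) /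
      k.factorial) atTop (𝓝 ((∏ i ∈ Finset.range k, 1) / k.factorial)) :=
    (tendsto_finsetProd _ fun i _ => tendsto_sub_natCast_div (d + i)).div_const _
  rw [Finset.prod_const_one] at h
  refine h.congr fun n => ?_
  rw [Nat.choose_eq_descFactorial_div_factorial, Nat.cast_div
    (Nat.factorial_dvd_descFactorial _ _) (by exact_mod_cast k.factorial_ne_zero),
    Nat.descFactorial_eq_prod_range, Finset.prod_div_distrib, Finset.prod_const,
    Finset.card_range]
  push_cast
  simp only [Nat.sub_sub]
  ring

lemma sum_list_sum_mul {T : Type*} [Fintype T] (a : α → T → ℂ) (b : T → ℂ) (L : List α) :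
    ∑ t, (L.map fun s => a s t).sum * b t = (L.map fun s => ∑ t, a s t * b t).sum := by
  induction L with
  | nil => simp
  | cons s L ih => simp [add_mul, Finset.sum_add_distrib, ih]

end ListProducts

/-! ### Recursion of the marginals in the number of layers -/

section Marginals

variable {p : ℕ}

/-- The average of `exp(i J x / √n)` for the phase `x` of two histories. -/
def interaction (ν : Measure ℝ) (γ : Fin p → ℝ) (n : ℕ) (s t : Site p) : ℂ :=
  charFun ν (phase γ s t / √n)

lemma interaction_comm (ν : Measure ℝ) (γ : Fin p → ℝ) (n : ℕ) (s t : Site p) :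
    interaction ν γ n s t = interaction ν γ n t s := by
  rw [interaction, interaction, phase_comm]

/-- The marginal of the averaged system at sites in the states `L`, with `m` further sites. -/
def marginal (ν : Measure ℝ) (γ β : Fin p → ℝ) (n : ℕ) (L : List (Site p)) (m : ℕ) : ℂ :=
  latticeSum (interaction ν γ n) (fun _ => 1)
    (L.map (mark (siteWeight β)) ++ List.replicate m (siteWeight β))

/-- The deviation from `1` of the field exerted by sites in the states `L`. -/
def fieldDeviation (ν : Measure ℝ) (γ : Fin p → ℝ) (n : ℕ) (L : List (Site p)) (s : Site p) : ℂ :=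
  (L.map fun t => interaction ν γ n t s).prod - 1

lemma ignoresFinal_interaction (ν : Measure ℝ) (γ : Fin (p + 1) → ℝ) (n : ℕ) :
    IgnoresFinal (interaction ν γ n) := by
  intro c x y z
  funext t
  have := ignoresFinal_phase γ t c x y z
  simp only [interaction, this]

lemma ignoresFinal_interaction_right (ν : Measure ℝ) (γ : Fin (p + 1) → ℝ) (n : ℕ)
    (s : Site (p + 1)) : IgnoresFinal (interaction ν γ n s) := by
  intro c x y z
  rw [interaction_comm, interaction_comm ν γ n s, ignoresFinal_interaction]

lemma ignoresFinal_fieldDeviation (ν : Measure ℝ) (γ : Fin (p + 1) → ℝ) (n : ℕ)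
    (L : List (Site (p + 1))) : IgnoresFinal (fieldDeviation ν γ n L) := by
  intro c x y z
  unfold fieldDeviation
  congr 3
  funext t
  exact ignoresFinal_interaction_right ν γ n t c x y z

/-- Marginals with `p + 1` layers in terms of marginals with `p` layers. -/
lemma marginal_succ (ν : Measure ℝ) (γ β : Fin (p + 1) → ℝ) (n : ℕ) (L : List (Site (p + 1)))
    (m : ℕ) : marginal ν γ β n L m =
      (L.map (siteWeight β)).prod * pairFactor (interaction ν γ n) L *
        ∑ k ∈ Finset.range (m + 1), (m.choose k : ℂ) * ∑ t : Fin k → Site p,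
          (∏ i, fieldDeviation ν γ n L (lift (t i))) *
            marginal ν (Fin.init γ) (Fin.init β) n (List.ofFn t) (m - k) := by
  unfold marginal
  rw [latticeSum_map_mark_append, latticeSum_field, List.map_replicate]
  -- The field of the prescribed sites is split into `1` plus its deviation; `k` will count the
  -- sites at which the deviation is chosen.
  have h1 : (fun s => siteWeight β s * (L.map fun t => interaction ν γ n t s).prod) =
      fun s => siteWeight β s + siteWeight β s * fieldDeviation ν γ n L s := by
    funext s
    unfold fieldDeviation
    ring
  rw [h1, latticeSum_replicate_add (interaction_comm ν γ n)]
  simp only [List.map_const', List.prod_replicate, one_pow, mul_one]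
  congr 1
  refine Finset.sum_congr rfl fun k _ => ?_
  congr 1
  -- The sites in `L` are already summed out, and every function left ignores the final spin, so the
  -- last layer disappears from all other sites.
  have h2 := latticeSum_lift β (φ' := interaction ν γ n) (φ := interaction ν (Fin.init γ) n)
    (fun s t => by rw [interaction, interaction, phase_lift]) (ignoresFinal_interaction ν γ n)
    (ignoresFinal_interaction_right ν γ n)
    (List.replicate k (fieldDeviation ν γ n L) ++ List.replicate (m - k) fun _ => 1) (by
      intro f hf
      rcases List.mem_append.1 hf with hf | hf
      · rw [List.eq_of_mem_replicate hf]
        exact ignoresFinal_fieldDeviation ν γ n L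
      · rw [List.eq_of_mem_replicate hf]
        exact fun _ _ _ _ => rfl) (fun _ => 1) (fun _ _ _ _ => rfl)
  simp only [List.map_append, List.map_replicate, mul_one] at h2
  exact h2.trans (latticeSum_replicate_append _ (fun t => fieldDeviation ν γ n L (lift t)) _ _ _)

/-! ### Uniform bounds and limits of the marginals -/

section Bounds

variable {ν : Measure ℝ} [IsProbabilityMeasure ν]

/-- Without layers the sites are independent. -/
lemma marginal_zero (γ β : Fin 0 → ℝ) (n : ℕ) (L : List (Site 0)) (m : ℕ) :
    marginal ν γ β n L m = (L.map (siteWeight β)).prod := by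
  have h1 : interaction ν γ n = fun _ _ => 1 := by
    funext s t
    simp [interaction, phase, Phi]
  have h2 : ∑ t : Site 0, siteWeight β t = 1 := by
    simp [siteWeight, Q]
  unfold marginal
  rw [h1]
  induction L with
  | nil =>
    induction m with
    | zero => simp
    | succ m ih => simpa [List.replicate_succ, latticeSum_cons, ← Finset.sum_mul, h2] using ih
  | cons t L ih => simpa [latticeSum_mark] using Or.inl ih

lemma norm_interaction_le (γ : Fin p → ℝ) (n : ℕ) (s t : Site p) :
    ‖interaction ν γ n s t‖ ≤ 1 := norm_charFun_le_one _

/-- A bound for the squares of the phases. -/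
def phaseBound (γ : Fin p → ℝ) : ℝ := ∑ s : Site p, ∑ t : Site p, 3 * phase γ s t ^ 2

lemma phaseBound_nonneg (γ : Fin p → ℝ) : 0 ≤ phaseBound γ :=
  Finset.sum_nonneg fun _ _ => Finset.sum_nonneg fun _ _ => by positivity

lemma phase_sq_le (γ : Fin p → ℝ) (s t : Site p) : 3 * phase γ s t ^ 2 ≤ phaseBound γ := by
  refine (Finset.single_le_sum (f := fun t => 3 * phase γ s t ^ 2)
    (fun _ _ => by positivity) (Finset.mem_univ t)).trans ?_
  exact Finset.single_le_sum (f := fun s => ∑ t : Site p, 3 * phase γ s t ^ 2)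
    (fun _ _ => Finset.sum_nonneg fun _ _ => by positivity) (Finset.mem_univ s)

lemma norm_interaction_sub_one_le
    (hν : MemLp id 2 ν) (hmean : ∫ x, x ∂ν = 0) (hvar : ∫ x, x ^ 2 ∂ν = 1)
    (γ : Fin p → ℝ) (n : ℕ) (s t : Site p) :
    ‖interaction ν γ n s t - 1‖ ≤ phaseBound γ / n := by
  refine (norm_charFun_sub_one_le hν hmean hvar _).trans ?_
  rw [div_pow, Real.sq_sqrt (Nat.cast_nonneg n), ← mul_div_assoc]
  exact div_le_div_of_nonneg_right (phase_sq_le γ s t) (Nat.cast_nonneg n)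

lemma norm_fieldDeviation_le
    (hν : MemLp id 2 ν) (hmean : ∫ x, x ∂ν = 0) (hvar : ∫ x, x ^ 2 ∂ν = 1)
    (γ : Fin p → ℝ) (n : ℕ) (L : List (Site p)) (s : Site p) :
    ‖fieldDeviation ν γ n L s‖ ≤ L.length * (phaseBound γ / n) :=
  norm_list_prod_map_sub_one_le (fun t => norm_interaction_le γ n t s)
    (fun t => norm_interaction_sub_one_le hν hmean hvar γ n t s) L

/-- The `k` deviations are of size `O(1/n)` each, and the binomial coefficient is at most `n^k /
k!`. The powers of `n` cancel, leaving the terms of an exponential series that do not depend on `n`.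
-/
lemma norm_expansion_term_le
    (hν : MemLp id 2 ν) (hmean : ∫ x, x ∂ν = 0) (hvar : ∫ x, x ^ 2 ∂ν = 1)
    (γ β : Fin (p + 1) → ℝ) {B : ℝ} (_hB : 0 ≤ B)
    (h : ∀ n L m, 0 < n → m ≤ n →
      ‖marginal ν (Fin.init γ) (Fin.init β) n L m‖ ≤ B ^ L.length)
    (n : ℕ) (L : List (Site (p + 1))) (m k : ℕ) (hn : 0 < n) (hm : m ≤ n) :
    ‖(m.choose k : ℂ) * ∑ t : Fin k → Site p,
      (∏ i, fieldDeviation ν γ n L (lift (t i))) *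
        marginal ν (Fin.init γ) (Fin.init β) n (List.ofFn t) (m - k)‖ ≤
      (L.length * (Fintype.card (Site p) * phaseBound γ * B)) ^ k / k.factorial := by
  have hn' : (0 : ℝ) < n := by exact_mod_cast hn
  have hc := phaseBound_nonneg γ
  have h1 : ‖∑ t : Fin k → Site p, (∏ i, fieldDeviation ν γ n L (lift (t i))) *
      marginal ν (Fin.init γ) (Fin.init β) n (List.ofFn t) (m - k)‖ ≤
      Fintype.card (Site p) ^ k * ((L.length * (phaseBound γ / n)) ^ k * B ^ k) := by
    have h2 : ∀ t ∈ (Finset.univ : Finset (Fin k → Site p)),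
        ‖(∏ i, fieldDeviation ν γ n L (lift (t i))) *
          marginal ν (Fin.init γ) (Fin.init β) n (List.ofFn t) (m - k)‖ ≤
        (L.length * (phaseBound γ / n)) ^ k * B ^ k := by
      intro t _
      rw [norm_mul, norm_prod]
      have h3 := h n (List.ofFn t) (m - k) hn (by omega)
      rw [List.length_ofFn] at h3
      refine mul_le_mul ?_ h3 (norm_nonneg _) (by positivity)
      refine (Finset.prod_le_prod (fun _ _ => norm_nonneg _) fun i _ =>
        norm_fieldDeviation_le hν hmean hvar γ n L (lift (t i))).trans ?_
      simp
    refine (norm_sum_le_of_le _ h2).trans (le_of_eq ?_)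
    rw [Finset.sum_const, Finset.card_univ, Fintype.card_fun, Fintype.card_fin, nsmul_eq_mul]
    push_cast
    ring
  have h4 : (m.choose k : ℝ) ≤ (n : ℝ) ^ k / k.factorial :=
    (Nat.choose_le_pow_div k m).trans (by gcongr)
  rw [norm_mul, Complex.norm_natCast]
  refine (mul_le_mul h4 h1 (norm_nonneg _) (by positivity)).trans (le_of_eq ?_)
  have h5 : ((n : ℝ)) ^ k * (phaseBound γ / n) ^ k = phaseBound γ ^ k := by
    rw [← mul_pow, mul_div_cancel₀ _ hn'.ne']
  rw [mul_pow, mul_pow, mul_pow, mul_pow, ← h5]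
  ring

/-- Marginals are bounded uniformly in the size of the system. -/
lemma exists_marginal_bound
    (hν : MemLp id 2 ν) (hmean : ∫ x, x ∂ν = 0) (hvar : ∫ x, x ^ 2 ∂ν = 1)
    (γ β : Fin p → ℝ) :
    ∃ B : ℝ, 1 ≤ B ∧ ∀ n L m, 0 < n → m ≤ n → ‖marginal ν γ β n L m‖ ≤ B ^ L.length := by
  induction p with
  | zero =>
    refine ⟨1, le_rfl, fun n L m _ _ => ?_⟩
    rw [marginal_zero]
    refine norm_list_prod_map_le zero_le_one (fun t => ?_) L
    norm_num [siteWeight, Q]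
  | succ p ih =>
    obtain ⟨B, hB1, hB⟩ := ih (Fin.init γ) (Fin.init β)
    have hB0 : 0 ≤ B := zero_le_one.trans hB1
    set A : ℝ := 1 + ∑ t, ‖siteWeight β t‖ with hA
    have hA1 : 1 ≤ A := by
      rw [hA, le_add_iff_nonneg_right]
      exact Finset.sum_nonneg fun _ _ => norm_nonneg _
    have hAt : ∀ t, ‖siteWeight β t‖ ≤ A := fun t =>
      (Finset.single_le_sum (f := fun t => ‖siteWeight β t‖) (fun _ _ => norm_nonneg _)
        (Finset.mem_univ t)).trans (by linarith)
    set D : ℝ := Fintype.card (Site p) * phaseBound γ * B with hD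
    have hD0 : 0 ≤ D := by have := phaseBound_nonneg γ; positivity
    refine ⟨A * Real.exp D, one_le_mul_of_one_le_of_one_le hA1 (Real.one_le_exp hD0),
      fun n L m hn hm => ?_⟩
    rw [marginal_succ, norm_mul, norm_mul, mul_pow]
    have h1 := norm_list_prod_map_le (zero_le_one.trans hA1) hAt L
    have h2 := norm_pairFactor_le (norm_interaction_le (ν := ν) γ n) L
    refine mul_le_mul ((mul_le_of_le_one_right (norm_nonneg _) h2).trans h1) ?_
      (norm_nonneg _) (by positivity)
    refine (norm_sum_le_of_le _ fun k _ =>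
      norm_expansion_term_le hν hmean hvar γ β hB0 hB n L m k hn hm).trans ?_
    -- The exponent is linear in the length of `L`, so the series is bounded by one factor `exp D`
    -- per prescribed site, and the bound keeps the form needed by the induction.
    rw [← Real.exp_nat_mul]
    exact Real.sum_le_exp_of_nonneg (by positivity) _

lemma tendsto_interaction
    (hν : MemLp id 2 ν) (hmean : ∫ x, x ∂ν = 0) (hvar : ∫ x, x ^ 2 ∂ν = 1)
    (γ : Fin p → ℝ) (s t : Site p) :
    Tendsto (fun n => interaction ν γ n s t) atTop (𝓝 1) := by
  rw [tendsto_iff_norm_sub_tendsto_zero]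
  exact squeeze_zero (fun _ => norm_nonneg _)
    (fun n => norm_interaction_sub_one_le hν hmean hvar γ n s t)
    (tendsto_const_div_atTop_nhds_zero_nat _)

lemma tendsto_fieldDeviation
    (hν : MemLp id 2 ν) (hmean : ∫ x, x ∂ν = 0) (hvar : ∫ x, x ^ 2 ∂ν = 1)
    (γ : Fin p → ℝ) (L : List (Site p)) (s : Site p) :
    Tendsto (fun n : ℕ => (n : ℂ) * fieldDeviation ν γ n L s) atTop
      (𝓝 (L.map fun t => -((phase γ t s : ℝ) : ℂ) ^ 2 / 2).sum) :=
  tendsto_natCast_mul_list_prod_map_sub_one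
    (fun t => tendsto_interaction hν hmean hvar γ t s)
    (fun _ => tendsto_charFun_sub_one hmean hvar _) L

/-- Marginals converge to products of solutions of the mean field equation. -/
theorem tendsto_marginal
    (hν : MemLp id 2 ν) (hmean : ∫ x, x ∂ν = 0) (hvar : ∫ x, x ^ 2 ∂ν = 1)
    {γ β : Fin p → ℝ} {w : Config p → ℂ} (hw : IsMeanField γ β w)
    (L : List (Site p)) (d : ℕ) :
    Tendsto (fun n => marginal ν γ β n L (n - d)) atTop
      (𝓝 (L.map fun t => w t.1 / 2).prod) := by
  induction p generalizing d with
  | zero =>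
    have : (fun t : Site 0 => w t.1 / 2) = siteWeight β := by
      funext t
      rw [hw.eqn, siteWeight]
      simp [Phi]
    simp only [marginal_zero, this]
    exact tendsto_const_nhds
  | succ p ih =>
    obtain ⟨B, hB1, hB⟩ :=
      exists_marginal_bound hν hmean hvar (Fin.init γ) (Fin.init β)
    have hB0 : 0 ≤ B := zero_le_one.trans hB1
    set D : ℝ := L.length * (Fintype.card (Site p) * phaseBound γ * B) with hD
    set g : Site p → ℂ := fun t =>
      (L.map fun s => -((phase γ s (lift t) : ℝ) : ℂ) ^ 2 / 2).sum with hg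
    set x : ℂ := ∑ t : Site p, g t * (reduce w t.1 / 2) with hx
    have hterm : ∀ k : ℕ, Tendsto (fun n : ℕ => ((n - d).choose k : ℂ) *
        ∑ t : Fin k → Site p, (∏ i, fieldDeviation ν γ n L (lift (t i))) *
          marginal ν (Fin.init γ) (Fin.init β) n (List.ofFn t) (n - d - k)) atTop
        (𝓝 (x ^ k / k.factorial)) := by
      intro k
      have h1 : Tendsto (fun n : ℕ => (((n - d).choose k : ℝ) / n ^ k : ℂ)) atTop
          (𝓝 (1 / k.factorial)) := by
        have := (Complex.continuous_ofReal.tendsto _).comp (tendsto_choose_div_pow d k)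
        simpa [Function.comp_def] using this
      have h2 : ∀ t : Fin k → Site p, Tendsto (fun n : ℕ =>
          (∏ i, (n : ℂ) * fieldDeviation ν γ n L (lift (t i))) *
            marginal ν (Fin.init γ) (Fin.init β) n (List.ofFn t) (n - (d + k))) atTop
          (𝓝 ((∏ i, g (t i)) * ∏ i, (reduce w (t i).1 / 2))) := by
        intro t
        refine (tendsto_finsetProd _ fun i _ =>
          tendsto_fieldDeviation hν hmean hvar γ L (lift (t i))).mul ?_
        -- The `k` expanded sites no longer count among the free ones; this is why the induction
        -- runs over all offsets `d`.
        have := ih hw.reduce (List.ofFn t) (d + k)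
        rwa [List.map_ofFn, List.prod_ofFn] at this
      have h3 := h1.mul (tendsto_finsetSum Finset.univ fun t _ => h2 t)
      have h4 : ∑ t : Fin k → Site p, (∏ i, g (t i)) * ∏ i, (reduce w (t i).1 / 2) = x ^ k := by
        rw [hx, Fintype.sum_pow]
        simp only [Finset.prod_mul_distrib]
      rw [h4, one_div_mul_eq_div] at h3
      refine h3.congr' ?_
      filter_upwards [eventually_gt_atTop 0] with n hn
      have hn' : (n : ℂ) ^ k ≠ 0 := pow_ne_zero _ (by exact_mod_cast hn.ne')
      simp only [Finset.prod_mul_distrib, Finset.prod_const, Finset.card_univ, Fintype.card_fin,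
        mul_assoc, Nat.sub_sub, ← Finset.mul_sum]
      push_cast
      field_simp
    have hsum : Tendsto (fun n : ℕ => ∑ k ∈ Finset.range (n - d + 1), ((n - d).choose k : ℂ) *
        ∑ t : Fin k → Site p, (∏ i, fieldDeviation ν γ n L (lift (t i))) *
          marginal ν (Fin.init γ) (Fin.init β) n (List.ofFn t) (n - d - k)) atTop
        (𝓝 (Complex.exp x)) := by
      have h1 := tendsto_tsum_of_dominated_convergence (𝓕 := atTop)
        (Real.summable_pow_div_factorial D) hterm (by
          filter_upwards [eventually_gt_atTop 0] with n hn k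
          exact norm_expansion_term_le hν hmean hvar γ β hB0 hB n L (n - d) k hn
            (Nat.sub_le _ _))
      rw [Complex.exp_eq_exp_ℂ, NormedSpace.exp_eq_tsum_div]
      refine h1.congr fun n => ?_
      refine tsum_eq_sum fun k hk => ?_
      -- Binomial coefficients vanish beyond `n - d`, so the finite expansion is a full series, to
      -- which dominated convergence applies.
      rw [Nat.choose_eq_zero_of_lt (by simpa using hk)]
      simp
    have hfin := (tendsto_const_nhds (x := (L.map (siteWeight β)).prod)).mul
      (tendsto_pairFactor (tendsto_interaction hν hmean hvar γ) L) |>.mul hsum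
    simp only [← marginal_succ] at hfin
    convert hfin using 2
    -- The exponent splits into one summand per prescribed site, namely the exponent in
    -- `eqn_reduce`; hence the limit is a product.
    have hx' : x = (L.map fun s => -(1 / 2) * ∑ c,
        reduce w c * ((Phi γ (extend c 1 1 * s.1) : ℝ) : ℂ) ^ 2).sum := by
      rw [hx, hg, sum_list_sum_mul]
      congr 1
      refine List.map_congr_left fun s _ => ?_
      rw [Fintype.sum_prod_type, Finset.mul_sum]
      refine Finset.sum_congr rfl fun c _ => ?_
      have hp : ∀ z, ((phase γ s (lift (c, z)) : ℝ) : ℂ) ^ 2 =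
          ((Phi γ (extend c 1 1 * s.1) : ℝ) : ℂ) ^ 2 := by
        intro z
        rw [← Complex.ofReal_pow, ← Complex.ofReal_pow, phase, lift, Phi_mul_comm]
        congr 1
        rw [mul_pow, mul_pow, sq (sgn s.2), sq (sgn z), sgn_mul_self, sgn_mul_self, one_mul,
          one_mul]
      simp only [hp, sum_units]
      ring
    rw [mul_one, hx', Complex.exp_list_sum, List.map_map, ← List.prod_map_mul]
    congr 1
    refine List.map_congr_left fun s _ => ?_
    rw [hw.eqn_reduce, siteWeight]
    simp only [Function.comp]
    ring

end Bounds

end Marginals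

/-! ## The state as a sum over paths -/

section Circuit

variable {n p : ℕ}

/-- The matrix elements of `exp(-iβX)` on one qubit, in terms of the product of the signs. -/
def mixEntry (β : ℝ) (x : ℤˣ) : ℂ :=
  if x = 1 then (Real.cos β : ℂ) else -Complex.I * (Real.sin β : ℂ)

/-- The matrix elements of `exp(-iβB)`. -/
def mixKernel (β : ℝ) (z' z : Spins n) : ℂ := ∏ j, mixEntry β (z' j * z j)

lemma hasDerivAt_mixEntry (β : ℝ) (x : ℤˣ) :
    HasDerivAt (fun b => mixEntry b x) (-Complex.I * mixEntry β (-x)) β := by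
  have hc : HasDerivAt (fun b : ℝ => ((Real.cos b : ℝ) : ℂ)) ((-Real.sin β : ℝ) : ℂ) β :=
    (Real.hasDerivAt_cos β).ofReal_comp
  have hs : HasDerivAt (fun b : ℝ => ((Real.sin b : ℝ) : ℂ)) ((Real.cos β : ℝ) : ℂ) β :=
    (Real.hasDerivAt_sin β).ofReal_comp
  rcases Int.units_eq_one_or x with rfl | rfl
  · simp only [mixEntry, if_true, show (-1 : ℤˣ) ≠ 1 by decide, if_false]
    convert hc using 1
    rw [← mul_assoc, neg_mul_neg, Complex.I_mul_I]
    push_cast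
    ring
  · simp only [mixEntry, show (-1 : ℤˣ) ≠ 1 by decide, if_false, neg_neg, if_true]
    exact hs.const_mul _

/-- Flip the `j`-th sign. -/
def flip (z : Spins n) (j : Fin n) : Spins n := Function.update z j (-z j)

lemma flip_flip (z : Spins n) (j : Fin n) : flip (flip z j) j = z := by
  simp [flip]

lemma pauliX_apply (j : Fin n) (z' z : Spins n) :
    pauliX j z' z = if z = flip z' j then 1 else 0 := by
  have : (z' = flip z j) ↔ z = flip z' j :=
    ⟨fun h => by rw [h, flip_flip], fun h => by rw [h, flip_flip]⟩
  simp only [pauliX, Matrix.of_apply]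
  exact if_congr this rfl rfl

lemma mixer_mul_mixKernel (β : ℝ) (z' z : Spins n) :
    ∑ k, mixer n z' k * mixKernel β k z = ∑ j, mixKernel β (flip z' j) z := by
  simp only [mixer, Matrix.sum_apply, Finset.sum_mul, pauliX_apply]
  rw [Finset.sum_comm]
  simp

/-- The product rule flips one qubit at a time, so the kernel solves the evolution equation
generated by `-iB`. -/
lemma hasDerivAt_mixKernel (β : ℝ) (z' z : Spins n) :
    HasDerivAt (fun b => mixKernel b z' z)
      (-Complex.I * ∑ k, mixer n z' k * mixKernel β k z) β := by
  have h := HasDerivAt.fun_finsetProd (u := Finset.univ)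
    (fun j (_ : j ∈ Finset.univ) => hasDerivAt_mixEntry β (z' j * z j))
  rw [mixer_mul_mixKernel, Finset.mul_sum]
  refine h.congr_deriv (Finset.sum_congr rfl fun j _ => ?_)
  unfold mixKernel
  rw [← Finset.mul_prod_erase Finset.univ _ (Finset.mem_univ j), smul_eq_mul]
  have h1 : ∏ k ∈ Finset.univ.erase j, mixEntry β (flip z' j k * z k) =
      ∏ k ∈ Finset.univ.erase j, mixEntry β (z' k * z k) := by
    refine Finset.prod_congr rfl fun k hk => ?_
    rw [flip, Function.update_of_ne (Finset.ne_of_mem_erase hk)]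
  rw [h1]
  simp only [flip, Function.update_self, neg_mul]
  ring

lemma hasDerivAt_exp_apply (A : Op n) (b : ℝ) (z' z : Spins n) :
    HasDerivAt (fun b : ℝ => NormedSpace.exp (b • A) z' z)
      ((NormedSpace.exp (b • A) * A) z' z) b := by
  let _ : NormedRing (Op n) := Matrix.linftyOpNormedRing
  let _ : NormedAlgebra ℝ (Op n) := Matrix.linftyOpNormedAlgebra
  have h := hasDerivAt_exp_smul_const (𝕂 := ℝ) A b
  have h2 := (LinearMap.toContinuousLinearMap
    (Matrix.entryLinearMap ℝ ℂ z' z)).hasFDerivAt.comp_hasDerivAt b h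
  exact h2

/-- The product has derivative zero in `β`, by the evolution equations of its two factors, and is
the identity at `β = 0`. -/
lemma exp_mul_mixKernel (β : ℝ) :
    NormedSpace.exp (β • (Complex.I • mixer n)) * Matrix.of (mixKernel β) = 1 := by
  set A : Op n := Complex.I • mixer n with hA
  have hd : ∀ z' z : Spins n, ∀ b : ℝ, HasDerivAt
      (fun b : ℝ => (NormedSpace.exp (b • A) * Matrix.of (mixKernel b) : Op n) z' z) 0 b := by
    intro z' z b
    simp only [Matrix.mul_apply, Matrix.of_apply]
    have h1 := HasDerivAt.fun_sum (u := Finset.univ) fun k (_ : k ∈ Finset.univ) =>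
      (hasDerivAt_exp_apply A b z' k).mul (hasDerivAt_mixKernel b k z)
    refine h1.congr_deriv ?_
    rw [Finset.sum_add_distrib]
    have h2 : ∑ k, (NormedSpace.exp (b • A) * A) z' k * mixKernel b k z =
        ∑ l, NormedSpace.exp (b • A) z' l * ∑ k, A l k * mixKernel b k z := by
      simp only [Matrix.mul_apply, Finset.sum_mul, Finset.mul_sum]
      rw [Finset.sum_comm]
      simp only [mul_assoc]
    rw [h2, ← Finset.sum_add_distrib]
    refine Finset.sum_eq_zero fun l _ => ?_
    simp only [hA, Matrix.smul_apply, smul_eq_mul, mul_assoc, ← Finset.mul_sum]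
    ring
  ext z' z
  have h := is_const_of_deriv_eq_zero (fun b => (hd z' z b).differentiableAt)
    (fun b => (hd z' z b).deriv) β 0
  rw [h, zero_smul, NormedSpace.exp_zero, one_mul, Matrix.of_apply, mixKernel, Matrix.one_apply]
  split_ifs with hz
  · subst hz
    simp [mixEntry, Int.units_mul_self]
  · obtain ⟨j, hj⟩ := Function.ne_iff.1 hz
    refine Finset.prod_eq_zero (Finset.mem_univ j) ?_
    have : z' j * z j ≠ 1 := by
      intro h'
      exact hj (by rw [← mul_one (z' j), ← Int.units_mul_self (z j), ← mul_assoc, h', one_mul])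
    simp [mixEntry, this]

lemma mixerUnitary_apply (β : ℝ) (z' z : Spins n) :
    mixerUnitary n β z' z = mixKernel β z' z := by
  have h : mixerUnitary n β = Matrix.of (mixKernel β) := by
    have h1 := exp_mul_mixKernel (n := n) β
    have h2 : mixerUnitary n β * NormedSpace.exp (β • (Complex.I • mixer n)) = 1 := by
      have h3 : -(Complex.I * (β : ℂ)) • mixer n = -(β • (Complex.I • mixer n)) := by
        rw [neg_smul, mul_comm, mul_smul, Complex.coe_smul]
      rw [mixerUnitary, h3, Matrix.exp_neg, Matrix.nonsing_inv_mul]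
      exact (Matrix.isUnit_iff_isUnit_det _).1 (Matrix.isUnit_exp _)
    rw [← mul_one (mixerUnitary n β), ← h1, ← mul_assoc, h2, one_mul]
  rw [h]; rfl

lemma costUnitary_eq (J : Couplings n) (γ : ℝ) :
    costUnitary J γ = Matrix.diagonal fun z => Complex.exp (-(Complex.I * γ) * cost J z) := by
  rw [costUnitary, costOp, ← Matrix.diagonal_smul, Matrix.exp_diagonal]
  congr 1
  funext z
  rw [Pi.coe_exp, ← Complex.exp_eq_exp_ℂ]
  rfl

lemma qaoaState_succ (J : Couplings n) (γ β : Fin (p + 1) → ℝ) :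
    qaoaState J γ β = mixerUnitary n (β (Fin.last p)) *ᵥ
      (costUnitary J (γ (Fin.last p)) *ᵥ qaoaState J (Fin.init γ) (Fin.init β)) := by
  unfold qaoaState
  rw [List.finRange_succ_last, List.foldl_append, List.foldl_map]
  rfl

/-- `C` for real-valued spins. -/
def spinCost (J : Couplings n) (v : Fin n → ℝ) : ℝ :=
  (1 / √n) * ∑ e : Pairs n, J e * v e.1.1 * v e.1.2

lemma cost_eq (J : Couplings n) (z : Spins n) : cost J z = spinCost J fun j => sgn (z j) := rfl

/-- The phase of a path that ends in `z`. -/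
def pathPhase (J : Couplings n) (γ : Fin p → ℝ) (z : Spins n) (a : Fin n → Fin p → ℤˣ) : ℝ :=
  ∑ r, γ r * spinCost J fun j => sgn (z j) * starProd (a j) r

/-- Histories with one more layer. -/
def snocEquiv (n p : ℕ) :
    (Fin n → ℤˣ) × (Fin n → Fin p → ℤˣ) ≃ (Fin n → Fin (p + 1) → ℤˣ) where
  toFun t j := Fin.snoc (α := fun _ => ℤˣ) (t.2 j) (t.1 j)
  invFun a := (fun j => a j (Fin.last p), fun j => Fin.init (a j))
  left_inv t := by simp
  right_inv a := by simp

/-- Paths are coded by their sign changes relative to the final string: the spin at cost layer `r`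
is `z_j` times the star product of `a j` at `r`, and `a j r` is the change made by mixer `r`. -/
lemma qaoaState_apply (J : Couplings n) (γ β : Fin p → ℝ) (z : Spins n) :
    qaoaState J γ β z = ((1 / √(2 ^ n) : ℝ) : ℂ) * ∑ a : Fin n → Fin p → ℤˣ,
      (∏ j, ∏ r, mixEntry (β r) (a j r)) *
        Complex.exp (-(Complex.I * (pathPhase J γ z a : ℝ))) := by
  induction p generalizing z with
  | zero => simp [qaoaState, uniformState, pathPhase]
  | succ p ih =>
    -- The string `z'` before the last mixer replaces the last sign change, which equals `z * z'`.
    rw [qaoaState_succ, costUnitary_eq, ← (snocEquiv n p).sum_comp, Fintype.sum_prod_type,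
      ← (Equiv.mulRight z).symm.sum_comp]
    rw [Matrix.mulVec, dotProduct]
    simp only [Matrix.mulVec_diagonal, ih, mixerUnitary_apply, Finset.mul_sum]
    refine Finset.sum_congr rfl fun z' _ => Finset.sum_congr rfl fun c _ => ?_
    have h1 : ∀ j, ((Equiv.mulRight z).symm z') j = z j * z' j := by
      intro j
      simp [Int.units_inv_eq_self, mul_comm]
    have h2 : pathPhase J γ z (snocEquiv n p ((Equiv.mulRight z).symm z', c)) =
        pathPhase J (Fin.init γ) z' c + γ (Fin.last p) * cost J z' := by
      have h3 : ∀ j, sgn (z j) * sgn (z j * z' j) = sgn (z' j) := by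
        intro j
        rw [sgn_mul, ← mul_assoc, sgn_mul_self, one_mul]
      unfold pathPhase
      rw [Fin.sum_univ_castSucc]
      simp only [snocEquiv, Equiv.coe_fn_mk, starProd_snoc_castSucc, starProd_snoc_last, h1, h3,
        cost_eq]
      congr 1
      refine Finset.sum_congr rfl fun r _ => ?_
      congr 2
      funext j
      rw [mul_left_comm, h3, mul_comm]
    have h4 : ∀ j, ∏ r, mixEntry (β r) (snocEquiv n p ((Equiv.mulRight z).symm z', c) j r) =
        (∏ r, mixEntry (Fin.init β r) (c j r)) * mixEntry (β (Fin.last p)) (z j * z' j) := by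
      intro j
      rw [Fin.prod_univ_castSucc]
      simp only [snocEquiv, Equiv.coe_fn_mk, Fin.snoc_castSucc, Fin.snoc_last, h1, Fin.init]
    rw [h2, Finset.prod_congr rfl fun j _ => h4 j, Finset.prod_mul_distrib, mixKernel]
    push_cast
    rw [mul_add, neg_add, Complex.exp_add, ← mul_assoc Complex.I, ← neg_mul (Complex.I * _)]
    ring

/-- Explains the form of `Q`: the first component of a configuration belongs to the bra, the second
to the ket. -/
lemma conj_mixEntry_mul (β : ℝ) (x y : ℤˣ) :
    starRingEnd ℂ (mixEntry β x) * mixEntry β y = mixFactor β x y := by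
  have h : (-1 : ℤˣ) ≠ 1 := by decide
  rcases Int.units_eq_one_or x with rfl | rfl <;> rcases Int.units_eq_one_or y with rfl | rfl <;>
    simp only [mixEntry, mixFactor, theta_one, theta_neg_one, h, if_true, if_false, neg_neg,
      map_mul, map_neg, Complex.conj_I, Complex.conj_ofReal] <;> norm_num
  · ring
  · ring
  · ring
  · linear_combination (-(Complex.sin β) ^ 2) * Complex.I_mul_I

lemma pathPhase_sub (J : Couplings n) (γ : Fin p → ℝ) (z : Spins n)
    (a b : Fin n → Fin p → ℤˣ) :
    pathPhase J γ z a - pathPhase J γ z b = ∑ e : Pairs n, J e *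
      (phase γ ((a e.1.1, b e.1.1), z e.1.1) ((a e.1.2, b e.1.2), z e.1.2) / √n) := by
  unfold pathPhase phase Phi spinCost
  rw [← Finset.sum_sub_distrib]
  simp only [Finset.mul_sum, ← Finset.sum_sub_distrib, Finset.sum_div]
  rw [Finset.sum_comm]
  refine Finset.sum_congr rfl fun e _ => Finset.sum_congr rfl fun r _ => ?_
  simp only [Prod.fst_mul, Prod.snd_mul, starProd_mul]
  ring

/-- The weight of a history of all qubits for fixed couplings. -/
def pathWeight (J : Couplings n) (γ β : Fin p → ℝ) (s : Fin n → Site p) : ℂ :=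
  (∏ j, siteWeight β (s j)) *
    ∏ e : Pairs n, Complex.exp ((phase γ (s e.1.1) (s e.1.2) / √n : ℝ) * J e * Complex.I)

/-- A path for the bra and one for the ket end in the same string `z`; the normalisation `2^{-n}` is
shared out as `1/2` per site. -/
lemma normSq_qaoaState (J : Couplings n) (γ β : Fin p → ℝ) (z : Spins n) :
    ((‖qaoaState J γ β z‖ ^ 2 : ℝ) : ℂ) = ∑ a : Fin n → Fin p → ℤˣ, ∑ b : Fin n → Fin p → ℤˣ,
      pathWeight J γ β fun j => ((a j, b j), z j) := by
  rw [Complex.ofReal_pow, ← Complex.conj_mul', qaoaState_apply, map_mul, map_sum,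
    mul_mul_mul_comm, Finset.sum_mul_sum, Complex.conj_ofReal, Finset.mul_sum]
  refine Finset.sum_congr rfl fun a _ => ?_
  rw [Finset.mul_sum]
  refine Finset.sum_congr rfl fun b _ => ?_
  have h1 : ((1 / √(2 ^ n) : ℝ) : ℂ) * ((1 / √(2 ^ n) : ℝ) : ℂ) = ∏ _j : Fin n, (1 / 2 : ℂ) := by
    rw [← Complex.ofReal_mul, div_mul_div_comm, Real.mul_self_sqrt (by positivity)]
    simp
  have h2 : starRingEnd ℂ (∏ j, ∏ r, mixEntry (β r) (a j r)) * (∏ j, ∏ r, mixEntry (β r) (b j r)) =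
      ∏ j, Q β (a j, b j) := by
    simp only [map_prod, ← Finset.prod_mul_distrib, conj_mixEntry_mul]
    rfl
  have h3 : starRingEnd ℂ (Complex.exp (-(Complex.I * (pathPhase J γ z a : ℝ)))) *
      Complex.exp (-(Complex.I * (pathPhase J γ z b : ℝ))) = ∏ e : Pairs n, Complex.exp
        ((phase γ ((a e.1.1, b e.1.1), z e.1.1) ((a e.1.2, b e.1.2), z e.1.2) / √n : ℝ) * J e *
          Complex.I) := by
    rw [← Complex.exp_conj, ← Complex.exp_add, ← Complex.exp_sum]
    congr 1
    simp only [map_neg, map_mul, Complex.conj_I, Complex.conj_ofReal]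
    rw [← Finset.sum_mul]
    have := congrArg (fun x : ℝ => (x : ℂ)) (pathPhase_sub J γ z a b)
    push_cast at this ⊢
    simp only [mul_comm (J _ : ℂ)] at this
    rw [← this]
    ring
  rw [map_mul, mul_mul_mul_comm (starRingEnd ℂ (∏ j, ∏ r, mixEntry (β r) (a j r))), h1, h2, h3,
    ← mul_assoc, ← Finset.prod_mul_distrib, pathWeight]
  congr 1
  exact Finset.prod_congr rfl fun j _ => by rw [siteWeight]; ring

/-- Expectations of diagonal observables as sums over histories. -/
lemma sum_mul_normSq_qaoaState (J : Couplings n) (γ β : Fin p → ℝ) (g : Spins n → ℝ) :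
    ((∑ z, g z * ‖qaoaState J γ β z‖ ^ 2 : ℝ) : ℂ) =
      ∑ s : Fin n → Site p, (g (fun j => (s j).2) : ℂ) * pathWeight J γ β s := by
  rw [← (Equiv.arrowProdEquivProdArrow (Fin n) (fun _ => Config p) fun _ => ℤˣ).symm.sum_comp,
    Fintype.sum_prod_type, Finset.sum_comm, Complex.ofReal_sum]
  refine Finset.sum_congr rfl fun z _ => ?_
  rw [Complex.ofReal_mul, normSq_qaoaState,
    ← (Equiv.arrowProdEquivProdArrow (Fin n) (fun _ => Fin p → ℤˣ)
      fun _ => Fin p → ℤˣ).symm.sum_comp, Fintype.sum_prod_type, Finset.mul_sum]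
  refine Finset.sum_congr rfl fun a _ => ?_
  rw [Finset.mul_sum]
  rfl

lemma energyOp_pow (J : Couplings n) (k : ℕ) :
    energyOp J ^ k = Matrix.diagonal fun z => (((cost J z / n) ^ k : ℝ) : ℂ) := by
  rw [energyOp, costOp, ← Matrix.diagonal_smul, Matrix.diagonal_pow]
  congr 1
  funext z
  simp only [Pi.pow_apply, Pi.smul_apply, smul_eq_mul]
  push_cast
  ring

lemma energyMoment_eq (k : ℕ) (J : Couplings n) (γ β : Fin p → ℝ) :
    energyMoment k γ β J = ∑ z, (cost J z / n) ^ k * ‖qaoaState J γ β z‖ ^ 2 := by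
  have : braket (qaoaState J γ β) (energyOp J ^ k) =
      ((∑ z, (cost J z / n) ^ k * ‖qaoaState J γ β z‖ ^ 2 : ℝ) : ℂ) := by
    rw [braket, energyOp_pow, dotProduct, Complex.ofReal_sum]
    refine Finset.sum_congr rfl fun z _ => ?_
    rw [Matrix.mulVec_diagonal, Complex.ofReal_mul _ (‖qaoaState J γ β z‖ ^ 2),
      Complex.ofReal_pow ‖qaoaState J γ β z‖, ← Complex.conj_mul']
    simp only [Pi.star_apply, RCLike.star_def]
    ring
  rw [energyMoment, this, Complex.ofReal_re]

lemma mixer_isHermitian (n : ℕ) : (mixer n).IsHermitian := by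
  refine Matrix.IsHermitian.ext fun z z' => ?_
  simp only [mixer, Matrix.sum_apply, star_sum]
  refine Finset.sum_congr rfl fun j _ => ?_
  rw [pauliX_apply, pauliX, Matrix.of_apply]
  split_ifs with h1 h2 h2 <;> simp_all [flip]

lemma exp_conjTranspose_mul_self {A : Op n} (hA : A.IsHermitian) (b : ℝ) :
    (NormedSpace.exp (-(Complex.I * (b : ℂ)) • A))ᴴ *
      NormedSpace.exp (-(Complex.I * (b : ℂ)) • A) = 1 := by
  rw [← Matrix.exp_conjTranspose, Matrix.conjTranspose_smul, hA.eq]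
  have : star (-(Complex.I * (b : ℂ))) • A = -(-(Complex.I * (b : ℂ)) • A) := by
    rw [← neg_smul]
    congr 1
    simp
  rw [this, Matrix.exp_neg, Matrix.nonsing_inv_mul]
  exact (Matrix.isUnit_iff_isUnit_det _).1 (Matrix.isUnit_exp _)

lemma star_dotProduct_mulVec {U : Op n} (hU : Uᴴ * U = 1) (ψ : Spins n → ℂ) :
    star (U *ᵥ ψ) ⬝ᵥ (U *ᵥ ψ) = star ψ ⬝ᵥ ψ := by
  rw [Matrix.star_mulVec, Matrix.dotProduct_mulVec, Matrix.vecMul_vecMul, hU, Matrix.vecMul_one]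

lemma star_dotProduct_qaoaState (J : Couplings n) (γ β : Fin p → ℝ) :
    star (qaoaState J γ β) ⬝ᵥ qaoaState J γ β = 1 := by
  induction p with
  | zero =>
    have : ((1 / √(2 ^ n) : ℝ) : ℂ) * ((1 / √(2 ^ n) : ℝ) : ℂ) = (1 / 2 ^ n : ℂ) := by
      rw [← Complex.ofReal_mul, div_mul_div_comm, Real.mul_self_sqrt (by positivity)]
      simp
    simp only [qaoaState, List.finRange_zero, List.foldl_nil, dotProduct, Pi.star_apply,
      uniformState, RCLike.star_def, Complex.conj_ofReal, this]
    simp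
  | succ p ih =>
    have hC : (costOp J).IsHermitian := by
      rw [costOp, Matrix.isHermitian_diagonal_iff]
      intro z
      simp [isSelfAdjoint_iff]
    have h1 : (mixerUnitary n (β (Fin.last p)))ᴴ * mixerUnitary n (β (Fin.last p)) = 1 :=
      exp_conjTranspose_mul_self (mixer_isHermitian n) _
    have h2 : (costUnitary J (γ (Fin.last p)))ᴴ * costUnitary J (γ (Fin.last p)) = 1 :=
      exp_conjTranspose_mul_self hC _
    rw [qaoaState_succ, star_dotProduct_mulVec h1, star_dotProduct_mulVec h2, ih]

lemma sum_normSq_qaoaState (J : Couplings n) (γ β : Fin p → ℝ) :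
    ∑ z, ‖qaoaState J γ β z‖ ^ 2 = 1 := by
  have h := star_dotProduct_qaoaState J γ β
  have h2 : star (qaoaState J γ β) ⬝ᵥ qaoaState J γ β =
      ((∑ z, ‖qaoaState J γ β z‖ ^ 2 : ℝ) : ℂ) := by
    rw [dotProduct, Complex.ofReal_sum]
    exact Finset.sum_congr rfl fun z _ => by
      rw [Complex.ofReal_pow, ← Complex.conj_mul']; rfl
  rw [h2] at h
  exact_mod_cast h

end Circuit

/-! ## Averages over the couplings -/

section Pairs

variable {n : ℕ}

lemma prod_pairs {M : Type*} [CommMonoid M] (f : Fin n → Fin n → M) :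
    ∏ e : Pairs n, f e.1.1 e.1.2 = ∏ i, ∏ j ∈ Finset.Ioi i, f i j := by
  rw [← Finset.prod_subtype (Finset.univ.filter fun e : Fin n × Fin n => e.1 < e.2)
    (fun e => by simp) (fun e => f e.1 e.2), Finset.prod_filter, Fintype.prod_prod_type]
  refine Finset.prod_congr rfl fun i _ => ?_
  rw [← Finset.prod_filter]
  exact Finset.prod_congr (by ext; simp) fun _ _ => rfl

lemma card_pairs_mul_two (n : ℕ) : Fintype.card (Pairs n) * 2 = n * (n - 1) := by
  have h := prod_pairs (n := n) (M := Multiplicative ℕ) fun _ _ => Multiplicative.ofAdd 1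
  have h2 : Fintype.card (Pairs n) = ∑ i : Fin n, (n - 1 - i) := by
    have := congrArg Multiplicative.toAdd h
    simpa [toAdd_prod] using this
  rw [h2, Fin.sum_univ_eq_sum_range (fun i => n - 1 - i), Finset.sum_range_reflect (fun i => i),
    Finset.sum_range_id_mul_two]

lemma card_pairs_le (n : ℕ) : Fintype.card (Pairs n) ≤ n ^ 2 := by
  have h := card_pairs_mul_two n
  have : n * (n - 1) ≤ n * n := Nat.mul_le_mul_left _ (Nat.sub_le _ _)
  nlinarith

lemma tendsto_card_pairs_div :
    Tendsto (fun n : ℕ => (Fintype.card (Pairs n) : ℝ) / n ^ 2) atTop (𝓝 (1 / 2)) := by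
  refine ((tendsto_sub_natCast_div 1).div_const 2).congr' ?_
  filter_upwards [eventually_gt_atTop 0] with n hn
  have h : (Fintype.card (Pairs n) : ℝ) * 2 = n * (n - 1 : ℕ) := by
    exact_mod_cast card_pairs_mul_two n
  have hn' : (n : ℝ) ≠ 0 := by exact_mod_cast hn.ne'
  rw [div_div, div_eq_div_iff (by positivity) (by positivity)]
  linear_combination (-(n : ℝ)) * h

/-- Two pairs have a site in common. -/
def Meets (e e' : Pairs n) : Prop :=
  e.1.1 = e'.1.1 ∨ e.1.1 = e'.1.2 ∨ e.1.2 = e'.1.1 ∨ e.1.2 = e'.1.2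

instance (e e' : Pairs n) : Decidable (Meets e e') := by
  unfold Meets; infer_instance

/-- Each of the four possible coincidences fixes one endpoint of `e'`, leaving at most `n` choices
for the other. -/
lemma card_filter_meets_le (e : Pairs n) :
    (Finset.univ.filter fun e' => Meets e e').card ≤ 4 * n := by
  have h1 : ∀ v : Fin n, (Finset.univ.filter fun e' : Pairs n => v = e'.1.1).card ≤ n := by
    intro v
    have := Finset.card_le_card_of_injOn (s := Finset.univ.filter fun e' : Pairs n => v = e'.1.1)
      (t := (Finset.univ : Finset (Fin n))) (fun e' => e'.1.2) (fun _ _ => Finset.mem_univ _) (by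
        intro a ha b hb hab
        simp only [Finset.coe_filter, Finset.mem_univ, true_and, Set.mem_ofPred_eq] at ha hb
        exact Subtype.ext (Prod.ext (ha.symm.trans hb) hab))
    simpa using this
  have h2 : ∀ v : Fin n, (Finset.univ.filter fun e' : Pairs n => v = e'.1.2).card ≤ n := by
    intro v
    have := Finset.card_le_card_of_injOn (s := Finset.univ.filter fun e' : Pairs n => v = e'.1.2)
      (t := (Finset.univ : Finset (Fin n))) (fun e' => e'.1.1) (fun _ _ => Finset.mem_univ _) (by
        intro a ha b hb hab
        simp only [Finset.coe_filter, Finset.mem_univ, true_and, Set.mem_ofPred_eq] at ha hb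
        exact Subtype.ext (Prod.ext hab (ha.symm.trans hb)))
    simpa using this
  simp only [Meets, Finset.filter_or]
  refine (Finset.card_union_le _ _).trans ?_
  have h3 := (Finset.card_union_le (Finset.univ.filter fun e' : Pairs n => e.1.1 = e'.1.2)
    ((Finset.univ.filter fun e' : Pairs n => e.1.2 = e'.1.1) ∪
      Finset.univ.filter fun e' : Pairs n => e.1.2 = e'.1.2))
  have h4 := (Finset.card_union_le (Finset.univ.filter fun e' : Pairs n => e.1.2 = e'.1.1)
      (Finset.univ.filter fun e' : Pairs n => e.1.2 = e'.1.2))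
  have := h1 e.1.1
  have := h2 e.1.1
  have := h1 e.1.2
  have := h2 e.1.2
  omega

end Pairs

section Averages

variable {n p : ℕ} {ν : Measure ℝ} [IsProbabilityMeasure ν]

instance : IsProbabilityMeasure (instanceLaw ν n) := by
  unfold instanceLaw; infer_instance

lemma monomial_mul_pathWeight (γ β : Fin p → ℝ) (m : Pairs n → ℕ) (s : Fin n → Site p)
    (J : Couplings n) :
    (∏ e, (J e : ℂ) ^ m e) * pathWeight J γ β s = (∏ j, siteWeight β (s j)) *
      ∏ e : Pairs n, ((J e : ℂ) ^ m e * Complex.exp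
        ((phase γ (s e.1.1) (s e.1.2) / √n : ℝ) * J e * Complex.I)) := by
  rw [Finset.prod_mul_distrib, pathWeight]
  ring

lemma integrable_monomial_mul_pathWeight (hν : MemLp id 2 ν) (γ β : Fin p → ℝ) {m : Pairs n → ℕ}
    (hm : ∀ e, m e ≤ 2) (s : Fin n → Site p) :
    Integrable (fun J : Couplings n => (∏ e, (J e : ℂ) ^ m e) * pathWeight J γ β s)
      (instanceLaw ν n) := by
  simp only [monomial_mul_pathWeight]
  refine Integrable.const_mul ?_ _
  exact Integrable.fintype_prod (f := fun (e : Pairs n) (x : ℝ) => (x : ℂ) ^ m e *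
    Complex.exp ((phase γ (s e.1.1) (s e.1.2) / √n : ℝ) * x * Complex.I))
    fun e => integrable_pow_mul_exp hν (hm e) _

lemma integral_monomial_mul_pathWeight (γ β : Fin p → ℝ) (m : Pairs n → ℕ)
    (s : Fin n → Site p) :
    ∫ J : Couplings n, (∏ e, (J e : ℂ) ^ m e) * pathWeight J γ β s ∂(instanceLaw ν n) =
      (∏ j, siteWeight β (s j)) *
        ∏ e : Pairs n, fourierMoment ν (m e) (phase γ (s e.1.1) (s e.1.2) / √n) := by
  simp only [monomial_mul_pathWeight]
  rw [integral_const_mul]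
  congr 1
  exact integral_fintype_prod_eq_prod (fun (e : Pairs n) (x : ℝ) => (x : ℂ) ^ m e *
    Complex.exp ((phase γ (s e.1.1) (s e.1.2) / √n : ℝ) * x * Complex.I))

/-- How often each pair occurs in a family of pairs. -/
def occurrences {k : ℕ} (ε : Fin k → Pairs n) (e : Pairs n) : ℕ :=
  (Finset.univ.filter fun i => ε i = e).card

lemma occurrences_le {k : ℕ} (ε : Fin k → Pairs n) (e : Pairs n) : occurrences ε e ≤ k :=
  (Finset.card_filter_le _ _).trans (by simp)

lemma prod_pow_occurrences {M : Type*} [CommMonoid M] {k : ℕ} (ε : Fin k → Pairs n)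
    (J : Pairs n → M) : ∏ i, J (ε i) = ∏ e, J e ^ occurrences ε e := by
  rw [← Finset.prod_fiberwise' Finset.univ ε J]
  simp [occurrences]

/-- The sign that a pair contributes to the cost function. -/
def pairSign (s t : Site p) : ℂ := sgn s.2 * sgn t.2

lemma energyMoment_eq_sum (γ β : Fin p → ℝ) (k : ℕ) (J : Couplings n) :
    (energyMoment k γ β J : ℂ) = ((n * √n : ℝ) : ℂ)⁻¹ ^ k * ∑ ε : Fin k → Pairs n,
      ∑ s : Fin n → Site p, (∏ i, pairSign (s (ε i).1.1) (s (ε i).1.2)) *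
        ((∏ e, (J e : ℂ) ^ occurrences ε e) * pathWeight J γ β s) := by
  rw [energyMoment_eq, sum_mul_normSq_qaoaState, Finset.sum_comm, Finset.mul_sum]
  refine Finset.sum_congr rfl fun s _ => ?_
  have h1 : ((cost J fun j => (s j).2) / n : ℝ) = (n * √n)⁻¹ *
      ∑ e : Pairs n, J e * sgn (s e.1.1).2 * sgn (s e.1.2).2 := by
    rw [cost, mul_inv]; ring
  rw [h1, mul_pow, Fintype.sum_pow]
  push_cast
  rw [mul_assoc, Finset.sum_mul]
  congr 1
  refine Finset.sum_congr rfl fun ε _ => ?_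
  rw [← prod_pow_occurrences ε fun e => (J e : ℂ), ← mul_assoc, ← Finset.prod_mul_distrib]
  congr 1
  refine Finset.prod_congr rfl fun i _ => ?_
  rw [pairSign]; ring

/-- With `k ≤ 2` factors of the cost function no coupling occurs more than twice, so second moments
of `ν` suffice. -/
lemma integrable_energyMoment_complex (hν : MemLp id 2 ν) (γ β : Fin p → ℝ) {k : ℕ} (hk : k ≤ 2) :
    Integrable (fun J : Couplings n => (energyMoment k γ β J : ℂ)) (instanceLaw ν n) := by
  simp only [energyMoment_eq_sum]
  refine Integrable.const_mul (integrable_finsetSum _ fun ε _ => integrable_finsetSum _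
    fun s _ => Integrable.const_mul ?_ _) _
  exact integrable_monomial_mul_pathWeight hν γ β (fun e => (occurrences_le ε e).trans hk) s

lemma integrable_energyMoment (hν : MemLp id 2 ν) (γ β : Fin p → ℝ) {k : ℕ} (hk : k ≤ 2) :
    Integrable (fun J : Couplings n => energyMoment k γ β J) (instanceLaw ν n) := by
  have := (integrable_energyMoment_complex (n := n) hν γ β hk).re
  simpa using this

/-- The average of a product of terms of the cost function. -/
def pairAverage (ν : Measure ℝ) (γ β : Fin p → ℝ) {k : ℕ} (ε : Fin k → Pairs n) : ℂ :=
  ∑ s : Fin n → Site p, (∏ i, pairSign (s (ε i).1.1) (s (ε i).1.2)) *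
    ((∏ j, siteWeight β (s j)) *
      ∏ e : Pairs n, fourierMoment ν (occurrences ε e) (phase γ (s e.1.1) (s e.1.2) / √n))

lemma integral_energyMoment (hν : MemLp id 2 ν) (γ β : Fin p → ℝ) {k : ℕ} (hk : k ≤ 2) :
    ((∫ J : Couplings n, energyMoment k γ β J ∂(instanceLaw ν n) : ℝ) : ℂ) =
      ((n * √n : ℝ) : ℂ)⁻¹ ^ k * ∑ ε : Fin k → Pairs n, pairAverage ν γ β ε := by
  rw [← integral_complex_ofReal]
  simp only [energyMoment_eq_sum]
  have h : ∀ (ε : Fin k → Pairs n) (s : Fin n → Site p), Integrable (fun J : Couplings n =>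
      (∏ i, pairSign (s (ε i).1.1) (s (ε i).1.2)) *
        ((∏ e, (J e : ℂ) ^ occurrences ε e) * pathWeight J γ β s)) (instanceLaw ν n) :=
    fun ε s => Integrable.const_mul (integrable_monomial_mul_pathWeight hν γ β
      (fun e => (occurrences_le ε e).trans hk) s) _
  rw [integral_const_mul, integral_finsetSum _ fun ε _ => integrable_finsetSum _ fun s _ => h ε s]
  congr 1
  refine Finset.sum_congr rfl fun ε _ => ?_
  rw [integral_finsetSum _ fun s _ => h ε s, pairAverage]
  refine Finset.sum_congr rfl fun s _ => ?_
  rw [integral_const_mul, integral_monomial_mul_pathWeight]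

end Averages

/-! ### Couplings inserted into the averaged system -/

section EdgeTerms

variable {n p : ℕ} {ν : Measure ℝ}

/-- The ratio of Fourier moments that an insertion of `J^k` contributes. -/
def momentRatio (ν : Measure ℝ) (γ : Fin p → ℝ) (n k : ℕ) (s t : Site p) : ℂ :=
  fourierMoment ν k (phase γ s t / √n) / interaction ν γ n s t

/-- Inserted powers of couplings become observables of the averaged system. Dividing by the
interaction requires it to be nonzero, which holds for large `n`. -/
lemma prod_fourierMoment (γ β : Fin p → ℝ)
    (h0 : ∀ s t : Site p, interaction ν γ n s t ≠ 0) (m : Pairs n → ℕ) (s : Fin n → Site p) :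
    (∏ j, siteWeight β (s j)) *
      ∏ e : Pairs n, fourierMoment ν (m e) (phase γ (s e.1.1) (s e.1.2) / √n) =
    (∏ e : Pairs n, momentRatio ν γ n (m e) (s e.1.1) (s e.1.2)) *
      gibbsWeight (interaction ν γ n) (siteWeight β) s := by
  rw [gibbsWeight, ← prod_pairs fun i j => interaction ν γ n (s i) (s j), mul_left_comm,
    ← Finset.prod_mul_distrib]
  congr 1
  refine Finset.prod_congr rfl fun e _ => ?_
  rw [momentRatio, div_mul_cancel₀ _ (h0 _ _)]

lemma momentRatio_zero (γ : Fin p → ℝ) {s t : Site p} (h0 : interaction ν γ n s t ≠ 0) :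
    momentRatio ν γ n 0 s t = 1 := by
  rw [momentRatio, fourierMoment_zero]
  exact div_self h0

/-- The term of a pair in averages of the cost function. -/
def edgeTerm (ν : Measure ℝ) (γ : Fin p → ℝ) (n : ℕ) (s t : Site p) : ℂ :=
  pairSign s t * momentRatio ν γ n 1 s t

lemma pairAverage_of_injective (γ β : Fin p → ℝ)
    (h0 : ∀ s t : Site p, interaction ν γ n s t ≠ 0) {k : ℕ} {ε : Fin k → Pairs n}
    (hε : Function.Injective ε) :
    pairAverage ν γ β ε = ∑ s : Fin n → Site p,
      (∏ i, edgeTerm ν γ n (s (ε i).1.1) (s (ε i).1.2)) *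
        gibbsWeight (interaction ν γ n) (siteWeight β) s := by
  unfold pairAverage
  refine Finset.sum_congr rfl fun s _ => ?_
  rw [prod_fourierMoment γ β h0, ← mul_assoc]
  congr 1
  simp only [edgeTerm, Finset.prod_mul_distrib]
  congr 1
  have h1 : ∀ i, occurrences ε (ε i) = 1 := by
    intro i
    simp [occurrences, hε.eq_iff, Finset.filter_eq']
  rw [← Finset.prod_subset (Finset.subset_univ (Finset.univ.image ε)),
    Finset.prod_image fun i _ j _ h => hε h]
  · simp only [h1]
  · intro e _ he
    have : occurrences ε e = 0 := by
      rw [occurrences, Finset.card_eq_zero, Finset.filter_eq_empty_iff]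
      intro i _ hi
      exact he (Finset.mem_image.2 ⟨i, Finset.mem_univ _, hi⟩)
    rw [this, momentRatio_zero γ (h0 _ _)]

lemma pairAverage_diag (γ β : Fin p → ℝ)
    (h0 : ∀ s t : Site p, interaction ν γ n s t ≠ 0) (e : Pairs n) :
    pairAverage ν γ β ![e, e] = ∑ s : Fin n → Site p,
      momentRatio ν γ n 2 (s e.1.1) (s e.1.2) *
        gibbsWeight (interaction ν γ n) (siteWeight β) s := by
  unfold pairAverage
  refine Finset.sum_congr rfl fun s _ => ?_
  rw [prod_fourierMoment γ β h0, ← mul_assoc]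
  congr 1
  have h1 : ∏ i : Fin 2, pairSign (s (![e, e] i).1.1) (s (![e, e] i).1.2) = 1 := by
    simp only [Fin.prod_univ_two, Matrix.cons_val_zero, Matrix.cons_val_one, pairSign]
    rw [mul_mul_mul_comm, ← Complex.ofReal_mul, ← Complex.ofReal_mul, sgn_mul_self, sgn_mul_self]
    simp
  rw [h1, one_mul, Finset.prod_eq_single e]
  · have : occurrences ![e, e] e = 2 := by
      rw [occurrences, Finset.filter_true_of_mem]
      · simp
      · intro i _
        fin_cases i <;> rfl
    rw [this]
  · intro e' _ he'
    have : occurrences ![e, e] e' = 0 := by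
      rw [occurrences, Finset.card_eq_zero, Finset.filter_eq_empty_iff]
      intro i _ hi
      fin_cases i <;> exact he' hi.symm
    rw [this, momentRatio_zero γ (h0 _ _)]
  · simp

end EdgeTerms

/-! ## The limits of the two moments -/

section Limits

variable {n p : ℕ} {ν : Measure ℝ}

lemma norm_sgn (s : ℤˣ) : ‖(sgn s : ℂ)‖ = 1 := by
  rcases Int.units_eq_one_or s with rfl | rfl <;> simp [sgn]

lemma norm_pairSign (s t : Site p) : ‖pairSign s t‖ = 1 := by
  rw [pairSign, norm_mul, norm_sgn, norm_sgn, one_mul]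

lemma abs_phase_le (γ : Fin p → ℝ) (s t : Site p) : |phase γ s t| ≤ 1 + phaseBound γ := by
  have h := phase_sq_le γ s t
  nlinarith [sq_abs (phase γ s t), sq_nonneg (|phase γ s t| - 1), abs_nonneg (phase γ s t)]

lemma norm_sum_gibbsWeight_le {γ β : Fin p → ℝ} {B : ℝ} (hB1 : 1 ≤ B)
    (hB : ∀ n L m, 0 < n → m ≤ n → ‖marginal ν γ β n L m‖ ≤ B ^ L.length) (hn : 0 < n)
    {k : ℕ} (i : Fin k → Fin n) (G : (Fin k → Site p) → ℂ) {g : ℝ} (hg : ∀ t, ‖G t‖ ≤ g) :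
    ‖∑ s : Fin n → Site p, G (s ∘ i) * gibbsWeight (interaction ν γ n) (siteWeight β) s‖ ≤
      g * (Fintype.card (Site p) * B) ^ k := by
  classical
  have hg0 : 0 ≤ g := (norm_nonneg _).trans (hg fun _ => 1)
  have hB0 : 0 ≤ B := zero_le_one.trans hB1
  -- The sites may coincide, as they do for overlapping pairs, so the marginal is taken at the
  -- distinct ones. There are at most `k` of them, and the base of the power is at least `1`.
  set S := Finset.univ.image i with hS
  have hcard : S.card ≤ k := Finset.card_image_le.trans (by simp)
  set ι := S.orderEmbOfFin rfl with hι
  have hr : ∀ l, ∃ r, ι r = i l := by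
    intro l
    have : i l ∈ Set.range ι := by
      rw [hι, Finset.range_orderEmbOfFin]
      simp [hS]
    exact this
  choose r hr using hr
  have h1 : ∀ s : Fin n → Site p, G (s ∘ i) = (fun t => G (t ∘ r)) (s ∘ ι) := by
    intro s
    congr 1
    funext l
    simp [hr]
  simp only [h1]
  rw [sum_gibbsWeight (interaction_comm ν γ n) (siteWeight β) ι ι.injective fun t => G (t ∘ r)]
  have h2 : ∀ t ∈ (Finset.univ : Finset (Fin S.card → Site p)),
      ‖G (t ∘ r) * marginal ν γ β n (List.ofFn t) (n - S.card)‖ ≤ g * B ^ S.card := by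
    intro t _
    rw [norm_mul]
    have h3 := hB n (List.ofFn t) (n - S.card) hn (Nat.sub_le _ _)
    rw [List.length_ofFn] at h3
    exact mul_le_mul (hg _) h3 (norm_nonneg _) hg0
  refine (norm_sum_le_of_le _ h2).trans ?_
  rw [Finset.sum_const, Finset.card_univ, Fintype.card_fun, Fintype.card_fin, nsmul_eq_mul]
  push_cast
  rw [mul_left_comm, ← mul_pow]
  refine mul_le_mul_of_nonneg_left (pow_le_pow_right₀ ?_ hcard) hg0
  refine one_le_mul_of_one_le_of_one_le ?_ hB1
  exact_mod_cast Fintype.card_pos (α := Site p)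

/-- The average of the term of one pair. -/
def onePairSum (ν : Measure ℝ) (γ β : Fin p → ℝ) (n : ℕ) : ℂ :=
  ∑ t : Fin 2 → Site p, edgeTerm ν γ n (t 0) (t 1) * marginal ν γ β n (List.ofFn t) (n - 2)

/-- The average of the product of the terms of two disjoint pairs. -/
def twoPairSum (ν : Measure ℝ) (γ β : Fin p → ℝ) (n : ℕ) : ℂ :=
  ∑ t : Fin 4 → Site p, edgeTerm ν γ n (t 0) (t 1) * edgeTerm ν γ n (t 2) (t 3) *
    marginal ν γ β n (List.ofFn t) (n - 4)

lemma pairAverage_one (γ β : Fin p → ℝ) (h0 : ∀ s t : Site p, interaction ν γ n s t ≠ 0)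
    (ε : Fin 1 → Pairs n) : pairAverage ν γ β ε = onePairSum ν γ β n := by
  rw [pairAverage_of_injective γ β h0 (Function.injective_of_subsingleton ε)]
  have hi : Function.Injective ![(ε 0).1.1, (ε 0).1.2] := by
    have := (ε 0).2.ne
    intro a b
    fin_cases a <;> fin_cases b <;> simp [this, this.symm]
  have := sum_gibbsWeight (interaction_comm ν γ n) (siteWeight β) _ hi
    fun t => edgeTerm ν γ n (t 0) (t 1)
  simpa [onePairSum, marginal] using this

lemma pairAverage_two (γ β : Fin p → ℝ) (h0 : ∀ s t : Site p, interaction ν γ n s t ≠ 0)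
    {e e' : Pairs n} (h : ¬ Meets e e') : pairAverage ν γ β ![e, e'] = twoPairSum ν γ β n := by
  have hne : e ≠ e' := by
    rintro rfl
    exact h (Or.inl rfl)
  rw [pairAverage_of_injective γ β h0 (by
    intro a b
    fin_cases a <;> fin_cases b <;> simp [hne, hne.symm])]
  have hi : Function.Injective ![e.1.1, e.1.2, e'.1.1, e'.1.2] := by
    have h1 := e.2.ne
    have h2 := e'.2.ne
    simp only [Meets, not_or] at h
    obtain ⟨h3, h4, h5, h6⟩ := h
    intro a b
    fin_cases a <;> fin_cases b <;> simp [h1, h2, h3, h4, h5, h6, Ne.symm, eq_comm]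
  have := sum_gibbsWeight (interaction_comm ν γ n) (siteWeight β) _ hi
    fun t => edgeTerm ν γ n (t 0) (t 1) * edgeTerm ν γ n (t 2) (t 3)
  simpa [twoPairSum, marginal, Fin.prod_univ_two] using this

lemma norm_momentRatio_two_le (hvar : ∫ x, x ^ 2 ∂ν = 1) (γ : Fin p → ℝ) {s t : Site p}
    (h : 1 / 2 ≤ ‖interaction ν γ n s t‖) : ‖momentRatio ν γ n 2 s t‖ ≤ 2 := by
  rw [momentRatio, norm_div, div_le_iff₀ (by linarith)]
  refine (norm_fourierMoment_two_le hvar _).trans ?_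
  linarith

/-- The limiting contribution of the histories of a pair of sites. -/
def pairLimit (γ β : Fin p → ℝ) (s t : Site p) : ℂ :=
  Complex.I * (Phi γ (s.1 * t.1) : ℝ) * (W γ β s.1 / 2 * (W γ β t.1 / 2))

/-- Star products are multiplicative, so each layer gives a difference of two squares, which factors
as sum times difference. -/
lemma sum_Phi_mul (γ : Fin p → ℝ) (w : Config p → ℂ) :
    ∑ a, ∑ b, (Phi γ (a * b) : ℂ) * (w a * w b) = ∑ r, (γ r : ℂ) *
      ((∑ u : Config p, ((starProd u.1 r + starProd u.2 r : ℝ) : ℂ) * w u) *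
        ∑ v : Config p, ((starProd v.1 r - starProd v.2 r : ℝ) : ℂ) * w v) := by
  have h1 : ∀ r, (∑ u : Config p, ((starProd u.1 r + starProd u.2 r : ℝ) : ℂ) * w u) *
      (∑ v : Config p, ((starProd v.1 r - starProd v.2 r : ℝ) : ℂ) * w v) =
      ∑ a, ∑ b, ((starProd (a * b).1 r - starProd (a * b).2 r : ℝ) : ℂ) * (w a * w b) := by
    intro r
    have h2 : (∑ u : Config p, ((starProd u.1 r + starProd u.2 r : ℝ) : ℂ) * w u) *
      (∑ v : Config p, ((starProd v.1 r - starProd v.2 r : ℝ) : ℂ) * w v) =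
      (∑ u, (starProd u.1 r : ℂ) * w u) * (∑ u, (starProd u.1 r : ℂ) * w u) -
        (∑ u, (starProd u.2 r : ℂ) * w u) * (∑ u, (starProd u.2 r : ℂ) * w u) := by
      simp only [Complex.ofReal_add, Complex.ofReal_sub, add_mul, sub_mul,
        Finset.sum_add_distrib, Finset.sum_sub_distrib]
      ring
    rw [h2, Finset.sum_mul_sum, Finset.sum_mul_sum, ← Finset.sum_sub_distrib]
    refine Finset.sum_congr rfl fun a _ => ?_
    rw [← Finset.sum_sub_distrib]
    refine Finset.sum_congr rfl fun b _ => ?_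
    rw [Prod.fst_mul, Prod.snd_mul, starProd_mul, starProd_mul]
    push_cast
    ring
  symm
  simp only [h1, Finset.mul_sum]
  rw [Finset.sum_comm]
  refine Finset.sum_congr rfl fun a _ => ?_
  rw [Finset.sum_comm]
  refine Finset.sum_congr rfl fun b _ => ?_
  rw [Phi, Complex.ofReal_sum, Finset.sum_mul]
  refine Finset.sum_congr rfl fun r _ => ?_
  push_cast
  ring

/-- `pairLimit` does not depend on the two final signs; summing over them cancels the factors `1/2`
of the marginals. -/
lemma sum_pairLimit (γ β : Fin p → ℝ) :
    ∑ t : Fin 2 → Site p, pairLimit γ β (t 0) (t 1) = 2 * energyFormula γ β := by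
  have h1 : 2 * energyFormula γ β =
      Complex.I * ∑ a, ∑ b, (Phi γ (a * b) : ℂ) * (W γ β a * W γ β b) := by
    rw [sum_Phi_mul, energyFormula]
    simp only [mul_assoc]
    ring
  rw [h1, ← (finTwoArrowEquiv (Site p)).symm.sum_comp, Fintype.sum_prod_type,
    Fintype.sum_prod_type, Finset.mul_sum]
  refine Finset.sum_congr rfl fun a _ => ?_
  simp only [finTwoArrowEquiv_symm_apply, Matrix.cons_val_zero, Matrix.cons_val_one, pairLimit]
  rw [sum_units, Fintype.sum_prod_type, ← Finset.sum_add_distrib, Finset.mul_sum]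
  refine Finset.sum_congr rfl fun b _ => ?_
  simp only [sum_units]
  ring

variable [IsProbabilityMeasure ν]

lemma eventually_half_le_norm_interaction
    (hν : MemLp id 2 ν) (hmean : ∫ x, x ∂ν = 0) (hvar : ∫ x, x ^ 2 ∂ν = 1)
    (γ : Fin p → ℝ) :
    ∀ᶠ n in atTop, ∀ s t : Site p, 1 / 2 ≤ ‖interaction ν γ n s t‖ := by
  rw [eventually_all]
  intro s
  rw [eventually_all]
  intro t
  have h := (tendsto_interaction hν hmean hvar γ s t).norm
  rw [norm_one] at h
  exact (h.eventually (eventually_gt_nhds (by norm_num))).mono fun _ h => h.le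

lemma norm_edgeTerm_le
    (hν : MemLp id 2 ν) (hmean : ∫ x, x ∂ν = 0) (hvar : ∫ x, x ^ 2 ∂ν = 1)
    (γ : Fin p → ℝ) {s t : Site p}
    (h : 1 / 2 ≤ ‖interaction ν γ n s t‖) :
    ‖edgeTerm ν γ n s t‖ ≤ 2 * (1 + phaseBound γ) / √n := by
  rw [edgeTerm, norm_mul, norm_pairSign, one_mul, momentRatio, norm_div, div_le_iff₀ (by linarith)]
  refine (norm_fourierMoment_one_le hν hmean hvar _).trans ?_
  rw [abs_div, abs_of_nonneg (Real.sqrt_nonneg _)]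
  have h1 := abs_phase_le γ s t
  have h2 := phaseBound_nonneg γ
  calc |phase γ s t| / √n ≤ (1 + phaseBound γ) / √n := by gcongr
    _ = 2 * (1 + phaseBound γ) / √n * (1 / 2) := by ring
    _ ≤ _ := by gcongr

lemma norm_edgeTerm_mul_le
    (hν : MemLp id 2 ν) (hmean : ∫ x, x ∂ν = 0) (hvar : ∫ x, x ^ 2 ∂ν = 1)
    (γ : Fin p → ℝ) {s t s' t' : Site p}
    (h : 1 / 2 ≤ ‖interaction ν γ n s t‖) (h' : 1 / 2 ≤ ‖interaction ν γ n s' t'‖) :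
    ‖edgeTerm ν γ n s t * edgeTerm ν γ n s' t'‖ ≤ (2 * (1 + phaseBound γ)) ^ 2 / n := by
  have h1 := norm_edgeTerm_le hν hmean hvar γ h
  have h2 := norm_edgeTerm_le hν hmean hvar γ h'
  rw [norm_mul]
  refine (mul_le_mul h1 h2 (norm_nonneg _) ((norm_nonneg _).trans h1)).trans (le_of_eq ?_)
  rw [div_mul_div_comm, Real.mul_self_sqrt (Nat.cast_nonneg n), sq]

/-- The signs in `pairSign` cancel those in `phase`, so only `Φ` survives. -/
lemma tendsto_edgeTerm
    (hν : MemLp id 2 ν) (hmean : ∫ x, x ∂ν = 0) (hvar : ∫ x, x ^ 2 ∂ν = 1)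
    (γ : Fin p → ℝ) (s t : Site p) :
    Tendsto (fun n : ℕ => ((√n : ℝ) : ℂ) * edgeTerm ν γ n s t) atTop
      (𝓝 (Complex.I * (Phi γ (s.1 * t.1) : ℝ))) := by
  have h := ((tendsto_fourierMoment_one hν hmean hvar (phase γ s t)).div
    (tendsto_interaction hν hmean hvar γ s t) one_ne_zero).const_mul (pairSign s t)
  convert h using 2
  · simp only [edgeTerm, momentRatio, Pi.div_apply]
    ring
  · rw [pairSign, phase]
    have h1 := congrArg (fun x : ℝ => (x : ℂ)) (sgn_mul_self s.2)
    have h2 := congrArg (fun x : ℝ => (x : ℂ)) (sgn_mul_self t.2)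
    push_cast at h1 h2 ⊢
    linear_combination (-Complex.I * (Phi γ (s.1 * t.1) : ℂ)) * h1 -
      Complex.I * (Phi γ (s.1 * t.1) : ℂ) * (sgn s.2 : ℂ) * (sgn s.2 : ℂ) * h2

lemma tendsto_onePairSum
    (hν : MemLp id 2 ν) (hmean : ∫ x, x ∂ν = 0) (hvar : ∫ x, x ^ 2 ∂ν = 1)
    (γ β : Fin p → ℝ) :
    Tendsto (fun n : ℕ => ((√n : ℝ) : ℂ) * onePairSum ν γ β n) atTop
      (𝓝 (2 * energyFormula γ β)) := by
  have h : ∀ t : Fin 2 → Site p, Tendsto (fun n : ℕ => ((√n : ℝ) : ℂ) *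
      edgeTerm ν γ n (t 0) (t 1) * marginal ν γ β n (List.ofFn t) (n - 2)) atTop
      (𝓝 (pairLimit γ β (t 0) (t 1))) := by
    intro t
    have h1 := tendsto_marginal hν hmean hvar (isMeanField_W γ β) (List.ofFn t) 2
    rw [List.map_ofFn, List.prod_ofFn, Fin.prod_univ_two] at h1
    have h2 := (tendsto_edgeTerm hν hmean hvar γ (t 0) (t 1)).mul h1
    exact h2
  have h3 := tendsto_finsetSum Finset.univ fun t _ => h t
  rw [sum_pairLimit] at h3
  refine h3.congr fun n => ?_
  rw [onePairSum, Finset.mul_sum]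
  exact Finset.sum_congr rfl fun t _ => by ring

lemma tendsto_twoPairSum
    (hν : MemLp id 2 ν) (hmean : ∫ x, x ∂ν = 0) (hvar : ∫ x, x ^ 2 ∂ν = 1)
    (γ β : Fin p → ℝ) :
    Tendsto (fun n : ℕ => (n : ℂ) * twoPairSum ν γ β n) atTop
      (𝓝 ((2 * energyFormula γ β) ^ 2)) := by
  have h : ∀ t : Fin 4 → Site p, Tendsto (fun n : ℕ => ((√n : ℝ) : ℂ) *
      edgeTerm ν γ n (t 0) (t 1) * (((√n : ℝ) : ℂ) * edgeTerm ν γ n (t 2) (t 3)) *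
        marginal ν γ β n (List.ofFn t) (n - 4)) atTop
      (𝓝 (pairLimit γ β (t 0) (t 1) * pairLimit γ β (t 2) (t 3))) := by
    intro t
    have h1 := tendsto_marginal hν hmean hvar (isMeanField_W γ β) (List.ofFn t) 4
    rw [List.map_ofFn, List.prod_ofFn, Fin.prod_univ_four] at h1
    have h2 := ((tendsto_edgeTerm hν hmean hvar γ (t 0) (t 1)).mul
      (tendsto_edgeTerm hν hmean hvar γ (t 2) (t 3))).mul h1
    convert h2 using 2
    simp only [pairLimit, Function.comp]
    ring
  have h3 := tendsto_finsetSum Finset.univ fun t _ => h t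
  have h4 : ∑ t : Fin 4 → Site p, pairLimit γ β (t 0) (t 1) * pairLimit γ β (t 2) (t 3) =
      (2 * energyFormula γ β) ^ 2 := by
    rw [← sum_pairLimit, sq, Finset.sum_mul_sum, ← (Fin.appendEquiv 2 2).sum_comp,
      Fintype.sum_prod_type]
    rfl
  rw [h4] at h3
  refine h3.congr fun n => ?_
  have h5 : ((√(n : ℝ) : ℝ) : ℂ) * ((√(n : ℝ) : ℝ) : ℂ) = n := by
    rw [← Complex.ofReal_mul, Real.mul_self_sqrt (Nat.cast_nonneg n)]; simp
  rw [twoPairSum, Finset.mul_sum, ← h5]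
  exact Finset.sum_congr rfl fun t _ => by ring

/-- The first moment converges to the energy formula. -/
theorem tendsto_integral_energyMoment_one
    (hν : MemLp id 2 ν) (hmean : ∫ x, x ∂ν = 0) (hvar : ∫ x, x ^ 2 ∂ν = 1)
    (γ β : Fin p → ℝ) :
    Tendsto (fun n : ℕ => ((∫ J, energyMoment 1 γ β J ∂(instanceLaw ν n) : ℝ) : ℂ)) atTop
      (𝓝 (energyFormula γ β)) := by
  have h1 : Tendsto (fun n : ℕ => (((Fintype.card (Pairs n) : ℝ) / n ^ 2 : ℝ) : ℂ)) atTop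
      (𝓝 ((1 / 2 : ℝ) : ℂ)) := (Complex.continuous_ofReal.tendsto _).comp tendsto_card_pairs_div
  have h2 := h1.mul (tendsto_onePairSum hν hmean hvar γ β)
  rw [show ((1 / 2 : ℝ) : ℂ) * (2 * energyFormula γ β) = energyFormula γ β by
    push_cast; ring] at h2
  refine h2.congr' ?_
  filter_upwards [eventually_half_le_norm_interaction hν hmean hvar γ, eventually_gt_atTop 0]
    with n hn hn0
  have h0 : ∀ s t : Site p, interaction ν γ n s t ≠ 0 := fun s t =>
    norm_pos_iff.1 (by linarith [hn s t])
  rw [integral_energyMoment hν γ β (by norm_num),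
    Finset.sum_congr rfl fun ε _ => pairAverage_one γ β h0 ε, Finset.sum_const, Finset.card_univ,
    Fintype.card_fun, Fintype.card_fin, pow_one, pow_one, nsmul_eq_mul]
  have h3 : ((√(n : ℝ) : ℝ) : ℂ) ^ 2 = n := by
    rw [← Complex.ofReal_pow, Real.sq_sqrt (Nat.cast_nonneg n)]; simp
  have h4 : ((√(n : ℝ) : ℝ) : ℂ) ≠ 0 := by
    exact_mod_cast (Real.sqrt_pos.2 (by exact_mod_cast hn0 : (0 : ℝ) < n)).ne'
  push_cast
  rw [← h3]
  field_simp

lemma norm_twoPairSum_le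
    (hν : MemLp id 2 ν) (hmean : ∫ x, x ∂ν = 0) (hvar : ∫ x, x ^ 2 ∂ν = 1)
    (γ β : Fin p → ℝ) {B : ℝ} (hB1 : 1 ≤ B)
    (hB : ∀ n L m, 0 < n → m ≤ n → ‖marginal ν γ β n L m‖ ≤ B ^ L.length) (hn0 : 0 < n)
    (hn : ∀ s t : Site p, 1 / 2 ≤ ‖interaction ν γ n s t‖) :
    ‖twoPairSum ν γ β n‖ ≤
      (2 * (1 + phaseBound γ)) ^ 2 / n * (Fintype.card (Site p) * B) ^ 4 := by
  have hB0 : 0 ≤ B := zero_le_one.trans hB1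
  have h1 : ∀ t ∈ (Finset.univ : Finset (Fin 4 → Site p)),
      ‖edgeTerm ν γ n (t 0) (t 1) * edgeTerm ν γ n (t 2) (t 3) *
        marginal ν γ β n (List.ofFn t) (n - 4)‖ ≤
      (2 * (1 + phaseBound γ)) ^ 2 / n * B ^ 4 := by
    intro t _
    have h3 := hB n (List.ofFn t) (n - 4) hn0 (Nat.sub_le _ _)
    rw [List.length_ofFn] at h3
    rw [norm_mul]
    exact mul_le_mul (norm_edgeTerm_mul_le hν hmean hvar γ (hn _ _) (hn _ _)) h3 (norm_nonneg _)
      (by positivity)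
  refine (norm_sum_le_of_le _ h1).trans (le_of_eq ?_)
  rw [Finset.sum_const, Finset.card_univ, Fintype.card_fun, Fintype.card_fin, nsmul_eq_mul]
  push_cast
  ring

lemma norm_pairAverage_sub_le
    (hν : MemLp id 2 ν) (hmean : ∫ x, x ∂ν = 0) (hvar : ∫ x, x ^ 2 ∂ν = 1)
    (γ β : Fin p → ℝ) {B : ℝ} (hB1 : 1 ≤ B)
    (hB : ∀ n L m, 0 < n → m ≤ n → ‖marginal ν γ β n L m‖ ≤ B ^ L.length) (hn0 : 0 < n)
    (hn : ∀ s t : Site p, 1 / 2 ≤ ‖interaction ν γ n s t‖) (e e' : Pairs n) :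
    ‖pairAverage ν γ β ![e, e'] - twoPairSum ν γ β n‖ ≤
      (if Meets e e' then
        2 * ((2 * (1 + phaseBound γ)) ^ 2 / n * (Fintype.card (Site p) * B) ^ 4) else 0) +
      (if e = e' then 2 * (Fintype.card (Site p) * B) ^ 4 else 0) := by
  have hB0 : 0 ≤ B := zero_le_one.trans hB1
  have h0 : ∀ s t : Site p, interaction ν γ n s t ≠ 0 := fun s t =>
    norm_pos_iff.1 (by linarith [hn s t])
  have h2 := norm_twoPairSum_le hν hmean hvar γ β hB1 hB hn0 hn
  by_cases hm : Meets e e'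
  · refine (norm_sub_le _ _).trans ?_
    rw [if_pos hm]
    by_cases he : e = e'
    · subst he
      rw [if_pos rfl, pairAverage_diag γ β h0]
      -- The two sites are listed twice so that the bound has the same power `4` as in the other
      -- cases.
      have h3 := norm_sum_gibbsWeight_le hB1 hB hn0 ![e.1.1, e.1.2, e.1.1, e.1.2]
        (fun t => momentRatio ν γ n 2 (t 0) (t 1))
        (fun t => norm_momentRatio_two_le hvar γ (hn _ _))
      have h4 : 0 ≤ (2 * (1 + phaseBound γ)) ^ 2 / n * (Fintype.card (Site p) * B) ^ 4 := by
        positivity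
      simp only [Function.comp, Matrix.cons_val_zero, Matrix.cons_val_one] at h3
      linarith
    · rw [if_neg he, add_zero, pairAverage_of_injective γ β h0 (by
        intro a b
        fin_cases a <;> fin_cases b <;> simp [he, Ne.symm he])]
      have h3 := norm_sum_gibbsWeight_le hB1 hB hn0 ![e.1.1, e.1.2, e'.1.1, e'.1.2]
        (fun t => edgeTerm ν γ n (t 0) (t 1) * edgeTerm ν γ n (t 2) (t 3))
        (fun t => norm_edgeTerm_mul_le hν hmean hvar γ (hn _ _) (hn _ _))
      simp only [Function.comp, Matrix.cons_val_zero, Matrix.cons_val_one, Matrix.cons_val] at h3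
      simp only [Fin.prod_univ_two, Matrix.cons_val_zero, Matrix.cons_val_one]
      linarith
  · have he : e ≠ e' := by
      rintro rfl
      exact hm (Or.inl rfl)
    rw [pairAverage_two γ β h0 hm, if_neg hm, if_neg he]
    simp

/-- The second moment converges to the square of the energy formula. -/
theorem tendsto_integral_energyMoment_two
    (hν : MemLp id 2 ν) (hmean : ∫ x, x ∂ν = 0) (hvar : ∫ x, x ^ 2 ∂ν = 1)
    (γ β : Fin p → ℝ) :
    Tendsto (fun n : ℕ => ((∫ J, energyMoment 2 γ β J ∂(instanceLaw ν n) : ℝ) : ℂ)) atTop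
      (𝓝 (energyFormula γ β ^ 2)) := by
  obtain ⟨B, hB1, hB⟩ := exists_marginal_bound hν hmean hvar γ β
  have hB0 : 0 ≤ B := zero_le_one.trans hB1
  set C : ℝ := (Fintype.card (Site p) * B) ^ 4 with hC
  have hC0 : 0 ≤ C := by positivity
  set E : ℝ := (2 * (1 + phaseBound γ)) ^ 2 with hE
  have hE0 : 0 ≤ E := by positivity
  have h1 : Tendsto (fun n : ℕ => (((Fintype.card (Pairs n) : ℝ) / n ^ 2 : ℝ) : ℂ)) atTop
      (𝓝 ((1 / 2 : ℝ) : ℂ)) := (Complex.continuous_ofReal.tendsto _).comp tendsto_card_pairs_div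
  have h2 := (h1.pow 2).mul (tendsto_twoPairSum hν hmean hvar γ β)
  rw [show ((1 / 2 : ℝ) : ℂ) ^ 2 * (2 * energyFormula γ β) ^ 2 = energyFormula γ β ^ 2 by
    push_cast; ring] at h2
  have h3 : Tendsto (fun n : ℕ => ((∫ J, energyMoment 2 γ β J ∂(instanceLaw ν n) : ℝ) : ℂ) -
      (((Fintype.card (Pairs n) : ℝ) / n ^ 2 : ℝ) : ℂ) ^ 2 * ((n : ℂ) * twoPairSum ν γ β n)) atTop
      (𝓝 0) := by
    -- Against the prefactor `n^{-3}` stand at most `4n³` meeting pairs of edges, each with an error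
    -- `2EC / n`, and at most `n²` diagonal ones with an additional `2C`.
    refine squeeze_zero_norm' ?_ (tendsto_const_div_atTop_nhds_zero_nat (8 * (E * C) + 2 * C))
    filter_upwards [eventually_half_le_norm_interaction hν hmean hvar γ, eventually_gt_atTop 0]
      with n hn hn0
    have hn0' : (0 : ℝ) < n := by exact_mod_cast hn0
    have hnC : (n : ℂ) ≠ 0 := by exact_mod_cast hn0.ne'
    have h4 : ((√(n : ℝ) : ℝ) : ℂ) ^ 2 = n := by
      rw [← Complex.ofReal_pow, Real.sq_sqrt (Nat.cast_nonneg n)]; simp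
    have h5 : ((∫ J, energyMoment 2 γ β J ∂(instanceLaw ν n) : ℝ) : ℂ) -
        (((Fintype.card (Pairs n) : ℝ) / n ^ 2 : ℝ) : ℂ) ^ 2 * ((n : ℂ) * twoPairSum ν γ β n) =
        ((n : ℂ) ^ 3)⁻¹ * ∑ e : Pairs n, ∑ e' : Pairs n,
          (pairAverage ν γ β ![e, e'] - twoPairSum ν γ β n) := by
      rw [integral_energyMoment hν γ β le_rfl, ← (finTwoArrowEquiv (Pairs n)).symm.sum_comp,
        Fintype.sum_prod_type]
      simp only [Finset.sum_sub_distrib, Finset.sum_const, Finset.card_univ, nsmul_eq_mul,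
        finTwoArrowEquiv_symm_apply]
      push_cast
      rw [inv_pow, mul_pow, h4]
      field_simp
    have h6 : ‖∑ e : Pairs n, ∑ e' : Pairs n,
        (pairAverage ν γ β ![e, e'] - twoPairSum ν γ β n)‖ ≤
        ∑ e : Pairs n, (4 * n * (2 * (E / n * C)) + 2 * C) := by
      refine norm_sum_le_of_le _ fun e _ => ?_
      refine (norm_sum_le_of_le _ fun e' _ =>
        norm_pairAverage_sub_le hν hmean hvar γ β hB1 hB hn0 hn e e').trans ?_
      rw [Finset.sum_add_distrib, ← Finset.sum_filter, Finset.sum_const, nsmul_eq_mul,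
        Finset.sum_ite_eq, if_pos (Finset.mem_univ _)]
      have : ((Finset.univ.filter fun e' => Meets e e').card : ℝ) ≤ 4 * n := by
        exact_mod_cast card_filter_meets_le e
      gcongr
    rw [h5, norm_mul, norm_inv, norm_pow, Complex.norm_natCast]
    rw [Finset.sum_const, Finset.card_univ, nsmul_eq_mul] at h6
    have h7 : (Fintype.card (Pairs n) : ℝ) ≤ (n : ℝ) ^ 2 := by exact_mod_cast card_pairs_le n
    calc ((n : ℝ) ^ 3)⁻¹ * ‖∑ e : Pairs n, ∑ e' : Pairs n,
        (pairAverage ν γ β ![e, e'] - twoPairSum ν γ β n)‖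
        ≤ ((n : ℝ) ^ 3)⁻¹ * ((n : ℝ) ^ 2 * (4 * n * (2 * (E / n * C)) + 2 * C)) := by
          refine mul_le_mul_of_nonneg_left (h6.trans ?_) (by positivity)
          exact mul_le_mul_of_nonneg_right h7 (by positivity)
      _ = (8 * (E * C) + 2 * C) / n := by
          field_simp
          ring
  have h8 := h3.add h2
  rw [zero_add] at h8
  refine h8.congr fun n => ?_
  ring

end Limits

/-! ## Concentration -/

section Concentration

variable {n p : ℕ} {ν : Measure ℝ}

/-- The mean square deviation of the measured energy from `c`. -/
lemma sum_sq_sub_mul_normSq (γ β : Fin p → ℝ) (J : Couplings n) (c : ℝ) :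
    ∑ z, (cost J z / n - c) ^ 2 * ‖qaoaState J γ β z‖ ^ 2 =
      energyMoment 2 γ β J - 2 * c * energyMoment 1 γ β J + c ^ 2 := by
  have h := sum_normSq_qaoaState J γ β
  rw [energyMoment_eq, energyMoment_eq]
  calc ∑ z, (cost J z / n - c) ^ 2 * ‖qaoaState J γ β z‖ ^ 2
      = ∑ z, ((cost J z / n) ^ 2 * ‖qaoaState J γ β z‖ ^ 2 -
          2 * c * ((cost J z / n) ^ 1 * ‖qaoaState J γ β z‖ ^ 2) +
          c ^ 2 * ‖qaoaState J γ β z‖ ^ 2) := Finset.sum_congr rfl fun z _ => by ring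
    _ = _ := by
      rw [Finset.sum_add_distrib, Finset.sum_sub_distrib, ← Finset.mul_sum, ← Finset.mul_sum, h,
        mul_one]

lemma energyMoment_variance_nonneg (γ β : Fin p → ℝ) (J : Couplings n) :
    0 ≤ energyMoment 2 γ β J - energyMoment 1 γ β J ^ 2 := by
  have h := sum_sq_sub_mul_normSq γ β J (energyMoment 1 γ β J)
  have h2 : 0 ≤ ∑ z, (cost J z / n - energyMoment 1 γ β J) ^ 2 * ‖qaoaState J γ β z‖ ^ 2 :=
    Finset.sum_nonneg fun _ _ => by positivity
  nlinarith

lemma measureProb_mul_sq_le (γ β : Fin p → ℝ) (J : Couplings n) (c : ℝ) {ε : ℝ} (hε : 0 < ε) :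
    measureProb γ β J {z | ε < |cost J z / n - c|} * ε ^ 2 ≤
      energyMoment 2 γ β J - 2 * c * energyMoment 1 γ β J + c ^ 2 := by
  rw [← sum_sq_sub_mul_normSq, measureProb, Finset.sum_mul]
  refine Finset.sum_le_sum fun z _ => ?_
  by_cases hz : ε < |cost J z / n - c|
  · rw [Set.indicator_of_mem (by exact hz), mul_comm]
    refine mul_le_mul_of_nonneg_right ?_ (by positivity)
    rw [← sq_abs (cost J z / n - c)]
    exact pow_le_pow_left₀ hε.le hz.le 2
  · rw [Set.indicator_of_notMem (by exact hz), zero_mul]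
    positivity

/-- The squared mean is dominated by the second moment, since the measurement variance is
nonnegative. -/
lemma integrable_energyMoment_sq [IsProbabilityMeasure ν] (hν : MemLp id 2 ν)
    (γ β : Fin p → ℝ) :
    Integrable (fun J : Couplings n => energyMoment 1 γ β J ^ 2) (instanceLaw ν n) := by
  refine (integrable_energyMoment hν γ β le_rfl).mono'
    ((integrable_energyMoment hν γ β (by norm_num)).aestronglyMeasurable.pow 2)
    (ae_of_all _ fun J => ?_)
  rw [Real.norm_of_nonneg (sq_nonneg _)]
  linarith [energyMoment_variance_nonneg γ β J]

/-- Markov's inequality for a sequence of nonnegative functions whose means tend to zero. -/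
lemma tendsto_measureReal_of_tendsto_integral {Ω : ℕ → Type*} [∀ n, MeasurableSpace (Ω n)]
    {μ : ∀ n, Measure (Ω n)} [∀ n, IsFiniteMeasure (μ n)] {f : ∀ n, Ω n → ℝ}
    {S : ∀ n, Set (Ω n)} (h0 : ∀ n ω, 0 ≤ f n ω) (hi : ∀ n, Integrable (f n) (μ n))
    (hf : Tendsto (fun n => ∫ ω, f n ω ∂(μ n)) atTop (𝓝 0)) {δ : ℝ} (hδ : 0 < δ)
    (hS : ∀ n, ∀ ω ∈ S n, δ ≤ f n ω) :
    Tendsto (fun n => (μ n).real (S n)) atTop (𝓝 0) := by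
  have h1 := hf.const_mul δ⁻¹
  rw [mul_zero] at h1
  refine squeeze_zero (fun _ => measureReal_nonneg) (fun n => ?_) h1
  have h2 := mul_meas_ge_le_integral_of_nonneg (ae_of_all (μ n) (h0 n)) (hi n) δ
  have h3 : (μ n).real (S n) ≤ (μ n).real {ω | δ ≤ f n ω} := measureReal_mono (hS n)
  rw [inv_mul_eq_div, le_div_iff₀ hδ, mul_comm]
  exact (mul_le_mul_of_nonneg_left h3 hδ.le).trans h2

lemma sq_integral_le_integral_sq {Ω : Type*} [MeasurableSpace Ω] {μ : Measure Ω}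
    [IsProbabilityMeasure μ] {f : Ω → ℝ} (h1 : Integrable f μ)
    (h2 : Integrable (fun ω => f ω ^ 2) μ) : (∫ ω, f ω ∂μ) ^ 2 ≤ ∫ ω, f ω ^ 2 ∂μ := by
  set c := ∫ ω, f ω ∂μ with hc
  have h3 : ∫ ω, (f ω ^ 2 - 2 * c * f ω + c ^ 2) ∂μ = (∫ ω, f ω ^ 2 ∂μ) - c ^ 2 := by
    rw [integral_add (f := fun ω => f ω ^ 2 - 2 * c * f ω) (h2.sub (h1.const_mul _))
      (integrable_const _), integral_sub h2 (h1.const_mul _), integral_const_mul, ← hc]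
    simp
    ring
  have h4 : 0 ≤ ∫ ω, (f ω ^ 2 - 2 * c * f ω + c ^ 2) ∂μ :=
    integral_nonneg fun ω => by
      have : f ω ^ 2 - 2 * c * f ω + c ^ 2 = (f ω - c) ^ 2 := by ring
      simp only [this, Pi.zero_apply]
      positivity
  linarith

end Concentration

end

end SKQAOA

open SKQAOA in
theorem mainTheorem2 (ν : Measure ℝ) [IsProbabilityMeasure ν] (hν : MemLp id 2 ν)
    (hmean : ∫ x, x ∂ν = 0) (hvar : ∫ x, x ^ 2 ∂ν = 1)
    (p : ℕ) (γ β : Fin p → ℝ) :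
    -- the formula for `V_p` is real
    SKQAOA.energyFormula γ β = (SKQAOA.V γ β : ℂ) ∧
    -- the expectations over instances exist
    (∀ n : ℕ,
      Integrable (fun J => SKQAOA.energyMoment 1 γ β J) (SKQAOA.instanceLaw ν n) ∧
      Integrable (fun J => SKQAOA.energyMoment 1 γ β J ^ 2) (SKQAOA.instanceLaw ν n) ∧
      Integrable (fun J => SKQAOA.energyMoment 2 γ β J) (SKQAOA.instanceLaw ν n)) ∧
    -- the two moments
    Tendsto (fun n : ℕ => ∫ J, SKQAOA.energyMoment 1 γ β J ∂(SKQAOA.instanceLaw ν n))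
      atTop (𝓝 (SKQAOA.V γ β)) ∧
    Tendsto (fun n : ℕ => (∫ J, SKQAOA.energyMoment 1 γ β J ∂(SKQAOA.instanceLaw ν n)) ^ 2)
      atTop (𝓝 (SKQAOA.V γ β ^ 2)) ∧
    Tendsto (fun n : ℕ => ∫ J, SKQAOA.energyMoment 2 γ β J ∂(SKQAOA.instanceLaw ν n))
      atTop (𝓝 (SKQAOA.V γ β ^ 2)) ∧
    -- concentration over instances
    Tendsto (fun n : ℕ => (∫ J, SKQAOA.energyMoment 1 γ β J ^ 2 ∂(SKQAOA.instanceLaw ν n)) -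
        (∫ J, SKQAOA.energyMoment 1 γ β J ∂(SKQAOA.instanceLaw ν n)) ^ 2)
      atTop (𝓝 0) ∧
    (∀ ε : ℝ, 0 < ε →
      Tendsto (fun n : ℕ => (SKQAOA.instanceLaw ν n).real
        {J | ε < |SKQAOA.energyMoment 1 γ β J - SKQAOA.V γ β|}) atTop (𝓝 0)) ∧
    -- the measurement variance is nonnegative and vanishes in mean and in probability
    (∀ (n : ℕ) (J : SKQAOA.Couplings n),
      0 ≤ SKQAOA.energyMoment 2 γ β J - SKQAOA.energyMoment 1 γ β J ^ 2) ∧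
    Tendsto (fun n : ℕ => ∫ J, (SKQAOA.energyMoment 2 γ β J - SKQAOA.energyMoment 1 γ β J ^ 2)
        ∂(SKQAOA.instanceLaw ν n)) atTop (𝓝 0) ∧
    (∀ ε : ℝ, 0 < ε →
      Tendsto (fun n : ℕ => (SKQAOA.instanceLaw ν n).real
        {J | ε < SKQAOA.energyMoment 2 γ β J - SKQAOA.energyMoment 1 γ β J ^ 2})
        atTop (𝓝 0)) ∧
    -- for typical instances, a measured string has energy close to `V_p`
    (∀ ε δ : ℝ, 0 < ε → 0 < δ →
      Tendsto (fun n : ℕ => (SKQAOA.instanceLaw ν n).real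
        {J | δ < SKQAOA.measureProb γ β J
          {z | ε < |SKQAOA.cost J z / n - SKQAOA.V γ β|}}) atTop (𝓝 0)) := by
  have hc1 := tendsto_integral_energyMoment_one hν hmean hvar γ β
  have hc2 := tendsto_integral_energyMoment_two hν hmean hvar γ β
  have hi1 : ∀ n, Integrable (fun J => energyMoment 1 γ β J) (instanceLaw ν n) :=
    fun n => integrable_energyMoment hν γ β (by norm_num)
  have hi2 : ∀ n, Integrable (fun J => energyMoment 2 γ β J) (instanceLaw ν n) :=
    fun n => integrable_energyMoment hν γ β le_rfl
  have his : ∀ n, Integrable (fun J => energyMoment 1 γ β J ^ 2) (instanceLaw ν n) :=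
    fun n => integrable_energyMoment_sq hν γ β
  -- The formula is a limit of real expectations, hence real; no direct symmetry argument is needed.
  have hreal : energyFormula γ β = (V γ β : ℂ) := by
    have h := (Complex.continuous_im.tendsto _).comp hc1
    have h0 : (energyFormula γ β).im = 0 :=
      tendsto_nhds_unique h (by simp [Function.comp_def])
    exact Complex.ext (by simp [V]) (by simpa using h0)
  have h1 : Tendsto (fun n : ℕ => ∫ J, energyMoment 1 γ β J ∂(instanceLaw ν n)) atTop
      (𝓝 (V γ β)) := by
    have h := (Complex.continuous_re.tendsto _).comp hc1
    simpa [Function.comp_def, V] using h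
  have h2 : Tendsto (fun n : ℕ => ∫ J, energyMoment 2 γ β J ∂(instanceLaw ν n)) atTop
      (𝓝 (V γ β ^ 2)) := by
    have h := (Complex.continuous_re.tendsto _).comp hc2
    rw [hreal, ← Complex.ofReal_pow, Complex.ofReal_re] at h
    simpa [Function.comp_def] using h
  have hsq := h1.pow 2
  have hvarn : ∀ (n : ℕ) (J : Couplings n),
      0 ≤ energyMoment 2 γ β J - energyMoment 1 γ β J ^ 2 :=
    fun n J => energyMoment_variance_nonneg γ β J
  -- Squeezed between `(E⟨C/n⟩)²` and `E⟨(C/n)²⟩`, both of which tend to `V²`.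
  have hs : Tendsto (fun n : ℕ => ∫ J, energyMoment 1 γ β J ^ 2 ∂(instanceLaw ν n)) atTop
      (𝓝 (V γ β ^ 2)) :=
    tendsto_of_tendsto_of_tendsto_of_le_of_le hsq h2
      (fun n => sq_integral_le_integral_sq (hi1 n) (his n))
      (fun n => integral_mono (his n) (hi2 n) fun J => by linarith [hvarn n J])
  have hmv : Tendsto (fun n : ℕ => ∫ J, (energyMoment 2 γ β J - energyMoment 1 γ β J ^ 2)
      ∂(instanceLaw ν n)) atTop (𝓝 0) := by
    have h := h2.sub hs
    rw [sub_self] at h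
    exact h.congr fun n => (integral_sub (hi2 n) (his n)).symm
  -- Mean square deviations from the constant `V`. The choice `f = ⟨C/n⟩²` serves for fluctuations
  -- over instances, `f = ⟨(C/n)²⟩` for those of measured strings.
  have hdev : ∀ {f : ∀ n, Couplings n → ℝ}, (∀ n, Integrable (f n) (instanceLaw ν n)) →
      Tendsto (fun n => ∫ J, f n J ∂(instanceLaw ν n)) atTop (𝓝 (V γ β ^ 2)) →
      (∀ n, Integrable (fun J => f n J - 2 * V γ β * energyMoment 1 γ β J + V γ β ^ 2)
        (instanceLaw ν n)) ∧
      Tendsto (fun n => ∫ J, (f n J - 2 * V γ β * energyMoment 1 γ β J + V γ β ^ 2)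
        ∂(instanceLaw ν n)) atTop (𝓝 0) := by
    intro f hf hlim
    have hsub : ∀ n, Integrable (fun J => f n J - 2 * V γ β * energyMoment 1 γ β J)
        (instanceLaw ν n) := fun n => (hf n).sub ((hi1 n).const_mul _)
    refine ⟨fun n => (hsub n).add (integrable_const _), ?_⟩
    have h := (hlim.sub (h1.const_mul (2 * V γ β))).add_const (V γ β ^ 2)
    rw [show V γ β ^ 2 - 2 * V γ β * V γ β + V γ β ^ 2 = 0 by ring] at h
    refine h.congr fun n => ?_
    rw [integral_add (hsub n) (integrable_const _), integral_sub (hf n) ((hi1 n).const_mul _),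
      integral_const_mul]
    simp
  refine ⟨hreal, fun n => ⟨hi1 n, his n, hi2 n⟩, h1, hsq, h2, ?_, ?_, hvarn, hmv, ?_, ?_⟩
  · have h := hs.sub hsq
    rwa [sub_self] at h
  · intro ε hε
    obtain ⟨ha, hb⟩ := hdev his hs
    refine tendsto_measureReal_of_tendsto_integral (fun n J => ?_) ha hb
      (by positivity : 0 < ε ^ 2) fun n J hJ => ?_
    · nlinarith [sq_nonneg (energyMoment 1 γ β J - V γ β)]
    · have hJ' : ε < |energyMoment 1 γ β J - V γ β| := hJ
      have h := pow_le_pow_left₀ hε.le hJ'.le 2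
      rw [sq_abs] at h
      nlinarith
  · intro ε hε
    exact tendsto_measureReal_of_tendsto_integral hvarn (fun n => (hi2 n).sub (his n)) hmv hε
      fun n J hJ => le_of_lt hJ
  · intro ε δ hε hδ
    obtain ⟨ha, hb⟩ := hdev hi2 h2
    refine tendsto_measureReal_of_tendsto_integral (fun n J => ?_) ha hb
      -- Chebyshev's inequality for the measurement: an instance that fails has mean square
      -- deviation at least `δ ε²`; Markov's inequality over `J` does the rest.
      (by positivity : 0 < δ * ε ^ 2) fun n J hJ => ?_
    · rw [← sum_sq_sub_mul_normSq]
      exact Finset.sum_nonneg fun _ _ => by positivity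
    · have hJ' : δ < measureProb γ β J {z | ε < |cost J z / n - V γ β|} := hJ
      exact (mul_le_mul_of_nonneg_right hJ'.le (by positivity)).trans
        (measureProb_mul_sq_le γ β J (V γ β) hε)
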